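/- Let $N\in\{1,2,\dots\}$, $t_1,t_2\in\mathbb{Z}_{\ge 0}$, $t_3>0$, $\gamma>0$, $(\alpha_1,\dots,\alpha_{t_1})\in[0,1]^{t_1}$ and $(\beta_{t_1+1},\dots,\beta_{t_1+t_2})\in\mathbb{R}_{\ge 0}^{t_2}$, and put $p_j=\beta_j/(1+\beta_j)$. The mixed TASEP$_{\boldsymbol\alpha,\boldsymbol\beta,\gamma}$ with $N$ particles is the Markov process $X_s=(X_s(N)<\dots<X_s(2)<X_s(1))$ on $\Omega_N=\{\vec x=(x_N,\dots,x_1)\in\mathbb{Z}^N: x_N<\dots<x_2<x_1\}$ that evolves as follows, with the convention $X_s(0)=+\infty$. (i) Geometric steps with parallel update, from time $k-1$ to $k$ for $k=1,\dots,t_1$: given $X_{k-1}=(a_i)$, the particles jump independently of each other, and particle $i$ jumps by $m$ sites with probability $\alpha_k^m(1-\alpha_k)$ if $0\le m\le a_{i-1}-a_i-2$, with probability $\alpha_k^m$ if $m=a_{i-1}-a_i-1$, and with probability $0$ otherwise (if $\alpha_k=1$, the first particle escapes to $+\infty$ and all transition probabilities to $\Omega_N$ are $0$). (ii) Bernoulli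 steps with sequential update, from time $k-1$ to $k$ for $k=t_1+1,\dots,t_1+t_2$: the particles $1,2,\dots,N$ are updated in this order, and particle $i$ jumps one site to the right with probability $p_k$ if $X_k(i-1)-X_{k-1}(i)>1$, and stays where it is otherwise. (iii) From time $t_1+t_2$ to $t=t_1+t_2+t_3$, the continuous time TASEP: each particle attempts to jump one site to the right at rate $\gamma$, and the jump takes place if the target site is empty. Then for all $\vec x,\vec y\in\Omega_N$ the transition probability has the determinantal form $$\mathbb{P}(X_t=\vec x\mid X_0=\vec y)=\det\bigl[F_{i-j}(x_{N+1-i}-y_{N+1-j},t)\bigr]_{1\le i,j\le N},$$ where $$F_n(x,t)=\frac{(-1)^n}{2\pi i}\oint_{\Gamma_{0,1}}dw\,\frac{(1-w)^{-n}}{w^{x-n+1}}f(w,t),\qquad f(w,t)=\prod_{j=1}^{t_1}\frac{1-\alpha_j}{1-\alpha_j w}\cdot\prod_{j=t_1+1}^{t_1+t_2}\frac{1+\beta_j w}{1+\beta_j}\cdot e^{\gamma t_3(w-1)},$$ and $\Gamma_{0,1}$ is any (piecewise continuously differentiable) simple loop oriented anticlockwise that encloses $w=0$ and $w=1$ and has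 the points $1/\alpha_j$ with $0<\alpha_j<1$ outside. -/

import Mathlib

open MeasureTheory ProbabilityTheory
open scoped NNReal BoundedContinuousFunction

namespace MixedTASEP

/-! ### Configurations -/

/-- Configurations of `N` particles on `ℤ`, labelled from right to left: the entry with index
`i : Fin N` is the position of the particle with label `i + 1`, so the entries decrease strictly. -/
abbrev Config (N : ℕ) : Type := {x : Fin N → ℤ // StrictAnti x}

variable {N : ℕ}

/-- The position, in the configuration `x`, of the particle immediately ahead (to the right) of
particle `i`; it is `⊤` for the rightmost particle, which has nobody ahead. -/
def front (x : Config N) (i : Fin N) : WithTop ℤ :=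
  if h : (i : ℕ) = 0 then ⊤ else ((x.1 ⟨(i : ℕ) - 1, by omega⟩ : ℤ) : WithTop ℤ)

/-! ### Geometric TASEP with parallel update -/

/-- One step of the geometric TASEP with parallel update: the probability to pass from `a` to `b`.
The particles move independently of each other given `a`. Particle `i` jumps by `m = b i - a i ≥ 0`
with probability `(1 - α) α ^ m` if it lands at least two sites behind the old position of its
predecessor, and with probability `α ^ m` if it lands on the site just behind that position. -/
noncomputable def geometricStep (α : ℝ) (a b : Config N) : ℝ :=
  ∏ i : Fin N,
    if a.1 i ≤ b.1 i then
      if ((b.1 i + 1 : ℤ) : WithTop ℤ) < front a i then (1 - α) * α ^ (b.1 i - a.1 i).toNat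
      else if ((b.1 i + 1 : ℤ) : WithTop ℤ) = front a i then α ^ (b.1 i - a.1 i).toNat
      else 0
    else 0

/-! ### Bernoulli TASEP with sequential update -/

/-- One step of the Bernoulli TASEP with sequential update from right to left: the probability to
pass from `a` to `b`. Given the new position of its predecessor, particle `i` jumps by one site with
probability `p` if the target site is free, and it stays otherwise. -/
noncomputable def bernoulliStep (p : ℝ) (a b : Config N) : ℝ :=
  ∏ i : Fin N,
    if ((a.1 i + 1 : ℤ) : WithTop ℤ) < front b i then
      if b.1 i = a.1 i then 1 - p else if b.1 i = a.1 i + 1 then p else 0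
    else
      if b.1 i = a.1 i then 1 else 0

/-! ### Continuous time TASEP -/

theorem strictAnti_update (x : Config N) (i : Fin N) (h : ∀ j, x.1 j ≠ x.1 i + 1) :
    StrictAnti (Function.update x.1 i (x.1 i + 1)) := by
  intro j k hjk
  have h1 := x.2 hjk
  have h2 := h j
  by_cases hj : j = i
  · subst hj
    have hk : k ≠ j := ne_of_gt hjk
    simp only [Function.update_self, Function.update_of_ne hk]
    omega
  · by_cases hk : k = i
    · subst hk
      simp only [Function.update_self, Function.update_of_ne hj]
      omega
    · simpa only [Function.update_of_ne hj, Function.update_of_ne hk] using h1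

/-- The configuration after particle `i` has attempted to jump to its right neighbouring site: the
jump takes place if that site is empty, otherwise nothing changes. -/
def hop (x : Config N) (i : Fin N) : Config N :=
  if h : ∀ j, x.1 j ≠ x.1 i + 1 then ⟨Function.update x.1 i (x.1 i + 1), strictAnti_update x i h⟩
  else x

theorem generator_bound (γ : ℝ) (f : Config N →ᵇ ℝ) (x : Config N) :
    ‖γ * ∑ i : Fin N, (f (hop x i) - f x)‖ ≤ |γ| * (N * 2) * ‖f‖ := by
  rw [norm_mul, Real.norm_eq_abs, mul_assoc]
  refine mul_le_mul_of_nonneg_left ?_ (abs_nonneg γ)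
  refine (norm_sum_le _ _).trans ?_
  have h : ∀ i ∈ Finset.univ, ‖f (hop x i) - f x‖ ≤ 2 * ‖f‖ := by
    intro i _
    have h1 := f.norm_coe_le_norm (hop x i)
    have h2 := f.norm_coe_le_norm x
    have h3 := norm_sub_le (f (hop x i)) (f x)
    linarith
  refine (Finset.sum_le_sum h).trans (le_of_eq ?_)
  simp only [Finset.sum_const, Finset.card_univ, Fintype.card_fin, nsmul_eq_mul]
  ring

/-- The generator of the continuous time TASEP with rate `γ`, a bounded operator on the bounded
functions of the configuration: `(L f)(x) = γ ∑ (f (x with particle i moved) - f x)`, the sum being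
over the particles `i` whose right neighbouring site is empty (the other terms vanish). -/
noncomputable def generator (N : ℕ) (γ : ℝ) : (Config N →ᵇ ℝ) →L[ℝ] (Config N →ᵇ ℝ) :=
  LinearMap.mkContinuous
    { toFun := fun f => BoundedContinuousFunction.ofNormedAddCommGroupDiscrete
        (fun x => γ * ∑ i : Fin N, (f (hop x i) - f x)) (|γ| * (N * 2) * ‖f‖)
        (generator_bound γ f)
      map_add' := fun f g => by
        ext x
        simp only [BoundedContinuousFunction.coe_ofNormedAddCommGroupDiscrete,
          BoundedContinuousFunction.coe_add, Pi.add_apply, ← mul_add, ← Finset.sum_add_distrib]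
        congr 1
        exact Finset.sum_congr rfl fun i _ => by ring
      map_smul' := fun c f => by
        ext x
        simp only [BoundedContinuousFunction.coe_ofNormedAddCommGroupDiscrete,
          BoundedContinuousFunction.coe_smul, smul_eq_mul, RingHom.id_apply, ← mul_sub,
          ← Finset.mul_sum]
        ring }
    (|γ| * (N * 2))
    (fun f => (BoundedContinuousFunction.norm_le (by positivity)).2 (generator_bound γ f))

/-- The indicator function of a single configuration. -/
noncomputable def indicatorFun (x : Config N) : Config N →ᵇ ℝ :=
  BoundedContinuousFunction.ofNormedAddCommGroupDiscrete (fun z => if z = x then (1 : ℝ) else 0) 1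
    (fun z => by split_ifs <;> simp)

set_option maxSynthPendingDepth 3 in
/-- The transition function of the continuous time TASEP: the Markov semigroup `exp (t L)` applied
to the indicator function of `x`, evaluated at the starting point `y`. -/
noncomputable def continuousTransition (γ t : ℝ) (y x : Config N) : ℝ :=
  NormedSpace.exp (t • generator N γ) (indicatorFun x) y

/-! ### The mixed process -/

/-- Composition of transition functions (Chapman-Kolmogorov): first `p`, then `q`. -/
noncomputable def compose (p q : Config N → Config N → ℝ) (y x : Config N) : ℝ :=
  ∑' z : Config N, p y z * q z x

/-- The probability to pass from `y` to `x` in the steps `1, …, k` of the geometric TASEP with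
parameters `α 1, …, α k`. -/
noncomputable def geometricTransition (α : ℕ → ℝ) : ℕ → Config N → Config N → ℝ
  | 0 => fun y x => if y = x then 1 else 0
  | k + 1 => compose (geometricTransition α k) (geometricStep (α (k + 1)))

/-- The probability to pass from `y` to `x` in the `k` steps `t₁ + 1, …, t₁ + k` of the Bernoulli
TASEP with hopping probabilities `β j / (1 + β j)`. -/
noncomputable def bernoulliTransition (β : ℕ → ℝ) (t₁ : ℕ) : ℕ → Config N → Config N → ℝ
  | 0 => fun y x => if y = x then 1 else 0
  | k + 1 => compose (bernoulliTransition β t₁ k)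
      (bernoulliStep (β (t₁ + k + 1) / (1 + β (t₁ + k + 1))))

/-- The transition probability of the mixed TASEP from `y` at time `0` to `x` at time
`t₁ + t₂ + t₃`: geometric dynamics up to time `t₁`, then Bernoulli dynamics up to time `t₁ + t₂`,
then continuous time dynamics during a time `t₃`. -/
noncomputable def mixedTransition (α β : ℕ → ℝ) (γ : ℝ) (t₁ t₂ : ℕ) (t₃ : ℝ≥0)
    (y x : Config N) : ℝ :=
  compose (compose (geometricTransition α t₁) (bernoulliTransition β t₁ t₂))
    (continuousTransition γ t₃) y x

/-- `X` is a mixed TASEP with respect to the filtration `ℱ` and the probability `P`: it is adapted,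
and, given the past, it performs a geometric step with parameter `α (k + 1)` from time `k` to
`k + 1` for `k < t₁`, a Bernoulli step with hopping probability `β (k + 1) / (1 + β (k + 1))` from
time `k` to `k + 1` for `t₁ ≤ k < t₁ + t₂`, and on the time interval `[t₁ + t₂, t₁ + t₂ + t₃]` it is
a Markov process whose semigroup is that of the continuous time TASEP. -/
structure IsMixedTASEP (α β : ℕ → ℝ) (γ : ℝ) (t₁ t₂ : ℕ) (t₃ : ℝ≥0) {Ω : Type*}
    {mΩ : MeasurableSpace Ω} (P : Measure Ω) (ℱ : Filtration ℝ≥0 mΩ)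
    (X : ℝ≥0 → Ω → Config N) : Prop where
  adapted : ∀ s : ℝ≥0, Measurable[ℱ s] (X s)
  geometric : ∀ k : ℕ, k < t₁ → ∀ A : Set Ω, MeasurableSet[ℱ (k : ℝ≥0)] A → ∀ a b : Config N,
    P.real (A ∩ X k ⁻¹' {a} ∩ X (k + 1) ⁻¹' {b}) =
      P.real (A ∩ X k ⁻¹' {a}) * geometricStep (α (k + 1)) a b
  bernoulli : ∀ k : ℕ, t₁ ≤ k → k < t₁ + t₂ → ∀ A : Set Ω, MeasurableSet[ℱ (k : ℝ≥0)] A →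
    ∀ a b : Config N,
    P.real (A ∩ X k ⁻¹' {a} ∩ X (k + 1) ⁻¹' {b}) =
      P.real (A ∩ X k ⁻¹' {a}) * bernoulliStep (β (k + 1) / (1 + β (k + 1))) a b
  continuous : ∀ s u : ℝ≥0, s ≤ u → u ≤ t₃ →
    ∀ A : Set Ω, MeasurableSet[ℱ ((t₁ : ℝ≥0) + t₂ + s)] A → ∀ a b : Config N,
    P.real (A ∩ X (t₁ + t₂ + s) ⁻¹' {a} ∩ X (t₁ + t₂ + u) ⁻¹' {b}) =
      P.real (A ∩ X (t₁ + t₂ + s) ⁻¹' {a}) * continuousTransition γ ((u : ℝ) - s) a b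

/-! ### Contour integrals -/

/-- A simple loop: a piecewise continuously differentiable closed curve, parametrized by `[0, 1]`,
without self-intersections. -/
structure IsSimpleLoop (c : ℝ → ℂ) : Prop where
  piecewise : ∃ (n : ℕ) (s : ℕ → ℝ), Monotone s ∧ s 0 = 0 ∧ s n = 1 ∧
    ∀ k < n, ContDiffOn ℝ 1 c (Set.Icc (s k) (s (k + 1)))
  closed : c 0 = c 1
  simple : Set.InjOn c (Set.Ico 0 1)

/-- The contour integral `∮ f(w) dw` along the curve `c`. -/
noncomputable def contourIntegral (c : ℝ → ℂ) (f : ℂ → ℂ) : ℂ :=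
  ∫ s in (0 : ℝ)..1, f (c s) * deriv c s

/-- The winding number of the closed curve `c` around a point `a` off the curve. -/
noncomputable def windingNumber (c : ℝ → ℂ) (a : ℂ) : ℂ :=
  (2 * Real.pi * Complex.I)⁻¹ * contourIntegral c (fun w => (w - a)⁻¹)

/-- The point `a` lies inside the loop `c`, and `c` runs anticlockwise around it. -/
def Encloses (c : ℝ → ℂ) (a : ℂ) : Prop :=
  (∀ s ∈ Set.Icc (0 : ℝ) 1, c s ≠ a) ∧ windingNumber c a = 1

/-- The point `a` lies outside the loop `c`. -/
def LeavesOutside (c : ℝ → ℂ) (a : ℂ) : Prop :=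
  (∀ s ∈ Set.Icc (0 : ℝ) 1, c s ≠ a) ∧ windingNumber c a = 0

/-- The symbol `f_{α,β,γ}(w, t)` of the mixed TASEP. -/
noncomputable def symbol (α β : ℕ → ℝ) (γ : ℝ) (t₁ t₂ : ℕ) (t₃ : ℝ≥0) (w : ℂ) : ℂ :=
  (∏ j ∈ Finset.Icc 1 t₁, (1 - (α j : ℂ)) / (1 - (α j : ℂ) * w)) *
    (∏ j ∈ Finset.Icc (t₁ + 1) (t₁ + t₂), (1 + (β j : ℂ) * w) / (1 + (β j : ℂ))) *
    Complex.exp ((γ : ℂ) * ((t₃ : ℝ) : ℂ) * (w - 1))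

/-- `F_n(x) = (-1)^n / (2πi) ∮ (1 - w)^{-n} / w^{x - n + 1} f(w) dw` along the curve `c`. -/
noncomputable def entryF (c : ℝ → ℂ) (f : ℂ → ℂ) (n x : ℤ) : ℂ :=
  (-1) ^ n / (2 * Real.pi * Complex.I) *
    contourIntegral c (fun w => (1 - w) ^ (-n) / w ^ (x - n + 1) * f w)

end MixedTASEP

/-! The argument runs backwards in the starting point. Fix the target `x` and regard `D_f(z) = det
[F_{j-i}(x_i - z_j)]` (`detF`) as a function of an arbitrary integer vector `z`, where `F` is formed
with a symbol `f` over a circle `|w| = R`, `R > 1`. Averaging `D_f` over one step of the dynamics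
started at `a` should give `D_g(a)`, with `g` the product of `f` and the factor of that step.

Two identities carry this. Multiplying the symbol by `a + b w` turns `F_n(v)` into `a F_n(v) + b
F_n(v - 1)` (`circleF_linear`), so each column evolves like the law of one free particle. And `F_n(v
- 1) - F_n(v) = F_{n-1}(v - 1)` (`circleF_sub`), so an error caused by exclusion in column `j` is a
multiple of column `j - 1` and disappears from the determinant. In particular, moving a particle
onto the site of its predecessor leaves `D_f` unchanged (`detF_update_of_blocked`).

For a geometric step the jumps are independent, the average is a determinant of one-particle sums,
and these telescope up to a multiple of the preceding column (`hasSum_geometricStep_detF`). For a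
Bernoulli step the reflection property allows the blocked jump laws to be replaced by free ones, one
particle at a time (`sum_unitBox_succ`). In continuous time the determinant solves the backward
equation, is entire in `t`, and equals the indicator of `x` at `t = 0` (`detF_one`); its Taylor
series is therefore the exponential series of the generator (`continuousTransition_eq_detF`).

Chapman-Kolmogorov sums are reassociated by absolute convergence, so the steps are absorbed from the
last to the first. If some `α_j = 1`, both sides vanish. Otherwise `R` is chosen with `1 < R` and
`α_j R < 1`, which makes the geometric sums converge and keeps the poles `1/α_j` outside the circle.
A general loop is compared with this circle by partial fractions and winding numbers only
(`IsLoopIntegral.eq_of_poles`). -/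

namespace MixedTASEP

/-! ### Integrals along closed curves -/

/-- The properties of the integral along a closed curve with trace `K` that determine its values on
meromorphic functions in terms of winding numbers. -/
structure IsLoopIntegral (K : Set ℂ) (I : (ℂ → ℂ) → ℂ) : Prop where
  bounded : Bornology.IsBounded K
  congr : ∀ f g : ℂ → ℂ, (∀ w ∈ K, f w = g w) → I f = I g
  add : ∀ f g : ℂ → ℂ, ContinuousOn f K → ContinuousOn g K → I (fun w => f w + g w) = I f + I g
  mul : ∀ (a : ℂ) (f : ℂ → ℂ), I (fun w => a * f w) = a * I f
  exact : ∀ F f : ℂ → ℂ, (∀ w ∈ K, HasDerivAt F (f w) w) → ContinuousOn f K → I f = 0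

theorem IsLoopIntegral.entire {K : Set ℂ} {I : (ℂ → ℂ) → ℂ} (h : IsLoopIntegral K I) {E : ℂ → ℂ}
    (hE : Differentiable ℂ E) : I E = 0 := by
  obtain ⟨r, hr⟩ := h.bounded.subset_ball 0
  obtain ⟨F, hF⟩ := (hE.differentiableOn (s := Metric.ball 0 r)).isExactOn_ball
  exact h.exact F E (fun w hw => hF w (hr hw)) hE.continuous.continuousOn

theorem continuousOn_prod_inv {K : Set ℂ} {E : ℂ → ℂ} (hE : Differentiable ℂ E)
    (L : Multiset ℂ) (hL : ∀ p ∈ L, p ∉ K) :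
    ContinuousOn (fun w => E w * (L.map fun p => (w - p)⁻¹).prod) K := by
  refine hE.continuous.continuousOn.mul ?_
  induction L using Multiset.induction_on with
  | empty => simpa using continuousOn_const
  | cons p L ih =>
    simp only [Multiset.map_cons, Multiset.prod_cons]
    refine ContinuousOn.mul ?_ (ih fun q hq => hL q (Multiset.mem_cons_of_mem hq))
    refine ContinuousOn.inv₀ (by fun_prop) ?_
    intro w hw h0
    exact hL p (Multiset.mem_cons_self p L) (by rwa [← sub_eq_zero.1 h0])

theorem IsLoopIntegral.pole_pow {K : Set ℂ} {I : (ℂ → ℂ) → ℂ} (h : IsLoopIntegral K I) {p : ℂ}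
    (hp : p ∉ K) (n : ℕ) : I (fun w => ((w - p)⁻¹) ^ (n + 2)) = 0 := by
  have hne : ∀ w ∈ K, w - p ≠ 0 := fun w hw h0 => hp (by rwa [← sub_eq_zero.1 h0])
  refine h.exact (fun w => -((n : ℂ) + 1)⁻¹ * ((w - p) ^ (n + 1))⁻¹) _ ?_ ?_
  · intro w hw
    have h1 := hne w hw
    have h3 : ((n : ℂ) + 1) ≠ 0 := by exact_mod_cast Nat.succ_ne_zero n
    have h2 := ((((hasDerivAt_id w).sub_const p).pow (n + 1)).inv (pow_ne_zero _ h1)).const_mul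
      (-((n : ℂ) + 1)⁻¹)
    refine HasDerivAt.congr_deriv (f := fun w => -((n : ℂ) + 1)⁻¹ * ((w - p) ^ (n + 1))⁻¹) h2 ?_
    simp only [id, Pi.pow_apply, Nat.add_sub_cancel, Nat.cast_add, Nat.cast_one, mul_one,
      inv_pow]
    field_simp
    ring
  · exact ContinuousOn.pow (ContinuousOn.inv₀ (by fun_prop) hne) _

/-- Two integrals along closed curves agree on a meromorphic function if the curves wind equally
often around its poles. -/
theorem IsLoopIntegral.eq_of_poles {K K' : Set ℂ} {I I' : (ℂ → ℂ) → ℂ} (h : IsLoopIntegral K I)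
    (h' : IsLoopIntegral K' I') (L : Multiset ℂ)
    (hL : ∀ p ∈ L, p ∉ K ∧ p ∉ K' ∧ I (fun w => (w - p)⁻¹) = I' (fun w => (w - p)⁻¹))
    (E : ℂ → ℂ) (hE : Differentiable ℂ E) :
    I (fun w => E w * (L.map fun p => (w - p)⁻¹).prod) =
      I' (fun w => E w * (L.map fun p => (w - p)⁻¹).prod) := by
  induction hn : L.card generalizing L E with
  | zero =>
    obtain rfl := Multiset.card_eq_zero.1 hn
    simp only [Multiset.map_zero, Multiset.prod_zero, mul_one]
    rw [h.entire hE, h'.entire hE]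
  | succ n ih =>
    obtain ⟨p, hpL⟩ := Multiset.card_pos_iff_exists_mem.1 (by omega : 0 < L.card)
    obtain ⟨L', rfl⟩ := Multiset.exists_cons_of_mem hpL
    have hp := hL p (Multiset.mem_cons_self p L')
    have hL' : ∀ q ∈ L', q ∉ K ∧ q ∉ K' ∧ I (fun w => (w - q)⁻¹) = I' (fun w => (w - q)⁻¹) :=
      fun q hq => hL q (Multiset.mem_cons_of_mem hq)
    have hcard : L'.card = n := by simpa using hn
    have hne : ∀ {S : Set ℂ} {q : ℂ}, q ∉ S → ∀ w ∈ S, w - q ≠ 0 :=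
      fun hq w hw h0 => hq (by rwa [← sub_eq_zero.1 h0])
    -- With a single multiple pole, split off the value `E p`: the remainder is an entire function
    -- with one pole factor fewer. With two distinct poles, partial fractions reduce to two products
    -- with one factor fewer each.
    by_cases hall : ∀ q ∈ L', q = p
    · obtain rfl := Multiset.eq_replicate.2 ⟨hcard, hall⟩
      have hE1 : Differentiable ℂ (dslope E p) := by
        rw [← differentiableOn_univ, Complex.differentiableOn_dslope Filter.univ_mem]
        exact hE.differentiableOn
      have hsplit : ∀ w, w - p ≠ 0 →
          E w * ((p ::ₘ Multiset.replicate n p).map fun p => (w - p)⁻¹).prod =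
          E p * ((w - p)⁻¹) ^ (n + 1) +
            dslope E p w * ((Multiset.replicate n p).map fun p => (w - p)⁻¹).prod := by
        intro w hw
        have h1 : E w = E p + (w - p) * dslope E p w := by
          have := sub_smul_dslope E p w
          rw [smul_eq_mul] at this
          rw [this]; ring
        simp only [Multiset.map_cons, Multiset.prod_cons, Multiset.map_replicate,
          Multiset.prod_replicate]
        rw [h1, pow_succ]
        field_simp
      have hval : ∀ {S : Set ℂ} {J : (ℂ → ℂ) → ℂ}, IsLoopIntegral S J → p ∉ S →
          J (fun w => E w * ((p ::ₘ Multiset.replicate n p).map fun p => (w - p)⁻¹).prod) =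
          E p * J (fun w => ((w - p)⁻¹) ^ (n + 1)) +
            J (fun w => dslope E p w *
              ((Multiset.replicate n p).map fun p => (w - p)⁻¹).prod) := by
        intro S J hJ hpS
        rw [← hJ.mul, ← hJ.add]
        · exact hJ.congr _ _ fun w hw => hsplit w (hne hpS w hw)
        · exact continuousOn_const.mul
            (ContinuousOn.pow (ContinuousOn.inv₀ (by fun_prop) (hne hpS)) _)
        · exact continuousOn_prod_inv hE1 _ fun q hq => by rwa [Multiset.eq_of_mem_replicate hq]
      rw [hval h hp.1, hval h' hp.2.1, ih _ hL' _ hE1 hcard]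
      congr 2
      -- Only the simple pole carries a winding number; higher powers of `(w - p)⁻¹` have a
      -- primitive and integrate to zero.
      cases n with
      | zero => simpa using hp.2.2
      | succ n => rw [h.pole_pow hp.1, h'.pole_pow hp.2.1]
    · push Not at hall
      obtain ⟨q, hq, hqp⟩ := hall
      obtain ⟨M, rfl⟩ := Multiset.exists_cons_of_mem hq
      have hpq : p - q ≠ 0 := sub_ne_zero.2 (Ne.symm hqp)
      have hval : ∀ {S : Set ℂ} {J : (ℂ → ℂ) → ℂ}, IsLoopIntegral S J →
          (∀ r ∈ p ::ₘ q ::ₘ M, r ∉ S) →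
          J (fun w => E w * ((p ::ₘ q ::ₘ M).map fun p => (w - p)⁻¹).prod) =
          (p - q)⁻¹ * (J (fun w => E w * ((p ::ₘ M).map fun p => (w - p)⁻¹).prod) +
            (-1) * J (fun w => E w * ((q ::ₘ M).map fun p => (w - p)⁻¹).prod)) := by
        intro S J hJ hS
        have c1 : ContinuousOn (fun w => E w * ((p ::ₘ M).map fun p => (w - p)⁻¹).prod) S :=
          continuousOn_prod_inv hE _ fun r hr => hS r (by
            simp only [Multiset.mem_cons] at hr ⊢; tauto)
        have c2 : ContinuousOn (fun w => E w * ((q ::ₘ M).map fun p => (w - p)⁻¹).prod) S :=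
          continuousOn_prod_inv hE _ fun r hr => hS r (by
            simp only [Multiset.mem_cons] at hr ⊢; tauto)
        rw [← hJ.mul (-1), ← hJ.add _ (fun w => -1 * (E w * ((q ::ₘ M).map fun p => (w - p)⁻¹).prod)) c1
            (continuousOn_const.mul c2), ← hJ.mul]
        refine hJ.congr _ _ fun w hw => ?_
        have h1 := hne (hS p (by simp)) w hw
        have h2 := hne (hS q (by simp)) w hw
        simp only [Multiset.map_cons, Multiset.prod_cons]
        field_simp
        ring
      rw [hval h fun r hr => (hL r hr).1, hval h' fun r hr => (hL r hr).2.1,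
        ih (p ::ₘ M) (fun r hr => hL r (by simp only [Multiset.mem_cons] at hr ⊢; tauto)) E hE
          (by simpa using hcard),
        ih (q ::ₘ M) (fun r hr => hL r (by simp only [Multiset.mem_cons] at hr ⊢; tauto)) E hE
          (by simpa using hcard)]

/-! ### Circles and piecewise differentiable loops -/

theorem isLoopIntegral_circle {R : ℝ} (hR : 0 ≤ R) :
    IsLoopIntegral (Metric.sphere 0 R) (fun f => ∮ w in C(0, R), f w) where
  bounded := Metric.isBounded_sphere
  congr _ _ hfg := circleIntegral.integral_congr hR fun w hw => hfg w hw
  add _ _ hf hg := circleIntegral.integral_add (hf.circleIntegrable hR) (hg.circleIntegrable hR)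
  mul a f := circleIntegral.integral_const_mul a f 0 R
  exact _ _ hF _ := circleIntegral.integral_eq_zero_of_hasDerivWithinAt hR
    fun w hw => (hF w hw).hasDerivWithinAt

theorem IsSimpleLoop.continuousOn {c : ℝ → ℂ} (hc : IsSimpleLoop c) :
    ContinuousOn c (Set.Icc 0 1) := by
  obtain ⟨n, s, hs, h0, h1, hk⟩ := hc.piecewise
  have key : ∀ k ≤ n, ContinuousOn c (Set.Icc 0 (s k)) := by
    intro k
    induction k with
    | zero => intro _; rw [h0, Set.Icc_self]; exact continuousOn_singleton c 0
    | succ k ih =>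
      intro hkn
      rw [← Set.Icc_union_Icc_eq_Icc (h0 ▸ hs (Nat.zero_le k)) (hs (Nat.le_succ k))]
      exact (ih (by omega)).union_of_isClosed (hk k (by omega)).continuousOn isClosed_Icc isClosed_Icc
  exact h1 ▸ key n le_rfl

/-- At a corner of the loop `deriv c` can be the default value 0. It agrees with the continuous
one-sided derivative inside the piece, and the two endpoints are a null set. -/
theorem deriv_contDiffOn_Icc {c : ℝ → ℂ} {a b : ℝ} (h : ContDiffOn ℝ 1 c (Set.Icc a b)) (hab : a < b) :
    (∀ s ∈ Set.Ioo a b, HasDerivAt c (deriv c s) s) ∧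
      IntervalIntegrable (deriv c) volume a b := by
  refine ⟨fun s hs => ?_, ?_⟩
  · exact ((h.differentiableOn one_ne_zero s (Set.Ioo_subset_Icc_self hs)).differentiableAt
      (Icc_mem_nhds hs.1 hs.2)).hasDerivAt
  · have h1 := h.continuousOn_derivWithin (uniqueDiffOn_Icc hab) le_rfl
    rw [← Set.uIcc_of_le hab.le] at h1
    refine h1.intervalIntegrable.congr_ae ?_
    rw [Set.uIoc_of_le hab.le, Set.uIcc_of_le hab.le, ← restrict_Ioo_eq_restrict_Ioc]
    filter_upwards [ae_restrict_mem measurableSet_Ioo] with s hs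
    exact derivWithin_of_mem_nhds (Icc_mem_nhds hs.1 hs.2)

theorem IsSimpleLoop.intervalIntegrable {c : ℝ → ℂ} (hc : IsSimpleLoop c) {f : ℂ → ℂ}
    (hf : ContinuousOn f (c '' Set.Icc 0 1)) :
    IntervalIntegrable (fun s => f (c s) * deriv c s) volume 0 1 := by
  have hd : IntervalIntegrable (deriv c) volume 0 1 := by
    obtain ⟨n, s, hs, h0, h1, hk⟩ := hc.piecewise
    rw [← h0, ← h1]
    refine IntervalIntegrable.trans_iterate fun k hkn => ?_
    rcases (hs (Nat.le_succ k)).eq_or_lt with h | h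
    · rw [Nat.succ_eq_add_one] at h
      rw [h]
    · exact (deriv_contDiffOn_Icc (hk k hkn) h).2
  refine hd.continuousOn_mul ?_
  rw [Set.uIcc_of_le zero_le_one]
  exact hf.comp hc.continuousOn (Set.mapsTo_image _ _)

theorem isLoopIntegral_contour {c : ℝ → ℂ} (hc : IsSimpleLoop c) :
    IsLoopIntegral (c '' Set.Icc 0 1) (contourIntegral c) where
  bounded := (isCompact_Icc.image_of_continuousOn hc.continuousOn).isBounded
  congr f g hfg := by
    refine intervalIntegral.integral_congr fun s hs => ?_
    rw [Set.uIcc_of_le zero_le_one] at hs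
    simp only [hfg _ (Set.mem_image_of_mem c hs)]
  add f g hf hg := by
    simp only [contourIntegral, add_mul]
    exact intervalIntegral.integral_add (hc.intervalIntegrable hf) (hc.intervalIntegrable hg)
  mul a f := by
    simp only [contourIntegral, mul_assoc]
    exact intervalIntegral.integral_const_mul _ _
  exact F f hF hf := by
    have hint := hc.intervalIntegrable hf
    have hcc := hc.continuousOn
    obtain ⟨n, s, hs, h0, h1, hk⟩ := hc.piecewise
    have hsub : ∀ k < n, Set.Icc (s k) (s (k + 1)) ⊆ Set.Icc 0 1 := fun k hkn =>
      Set.Icc_subset_Icc (h0 ▸ hs (Nat.zero_le k)) (h1 ▸ hs hkn)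
    have hint' : ∀ k < n, IntervalIntegrable (fun u => f (c u) * deriv c u) volume
        (s k) (s (k + 1)) := by
      intro k hkn
      refine hint.mono_set ?_
      rw [Set.uIcc_of_le (hs (Nat.le_succ k)), Set.uIcc_of_le zero_le_one]
      exact hsub k hkn
    have hpiece : ∀ k < n, ∫ u in (s k)..(s (k + 1)), f (c u) * deriv c u =
        F (c (s (k + 1))) - F (c (s k)) := by
      intro k hkn
      rcases (hs (Nat.le_succ k)).eq_or_lt with h | h
      · rw [Nat.succ_eq_add_one] at h
        rw [← h]; simp
      · refine intervalIntegral.integral_eq_sub_of_hasDerivAt_of_le (f := fun u => F (c u)) h.le ?_ ?_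
          (hint' k hkn)
        · intro u hu
          have h2 := (hF _ (Set.mem_image_of_mem c (hsub k hkn hu))).continuousAt
          exact h2.comp_continuousWithinAt ((hcc.mono (hsub k hkn)) u hu)
        · intro u hu
          exact (hF _ (Set.mem_image_of_mem c (hsub k hkn (Set.Ioo_subset_Icc_self hu)))).comp u
            ((deriv_contDiffOn_Icc (hk k hkn) h).1 u hu)
    -- The increments of `F ∘ c` over the pieces telescope to `F (c 1) - F (c 0)`, which is zero
    -- because the curve is closed.
    have htot := intervalIntegral.sum_integral_adjacent_intervals hint'
    rw [h0, h1] at htot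
    rw [contourIntegral, ← htot, Finset.sum_congr rfl fun k hk => hpiece k (Finset.mem_range.1 hk),
      Finset.sum_range_sub (fun k => F (c (s k))), h0, h1, hc.closed, sub_self]

/-- Entire functions multiplied with finitely many simple pole factors `(w - p)⁻¹`, where `p`
satisfies `Q`. -/
def IsPoleProduct (Q : ℂ → Prop) (g : ℂ → ℂ) : Prop :=
  ∃ (E : ℂ → ℂ) (L : Multiset ℂ), Differentiable ℂ E ∧ (∀ p ∈ L, Q p) ∧
    g = fun w => E w * (L.map fun p => (w - p)⁻¹).prod

theorem IsPoleProduct.mul {Q : ℂ → Prop} {f g : ℂ → ℂ} (hf : IsPoleProduct Q f)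
    (hg : IsPoleProduct Q g) : IsPoleProduct Q (fun w => f w * g w) := by
  obtain ⟨E, L, hE, hL, rfl⟩ := hf
  obtain ⟨E', L', hE', hL', rfl⟩ := hg
  refine ⟨fun w => E w * E' w, L + L', hE.mul hE', ?_, ?_⟩
  · intro p hp
    exact (Multiset.mem_add.1 hp).elim (hL p) (hL' p)
  · ext w
    simp only [Multiset.map_add, Multiset.prod_add]
    ring

theorem IsPoleProduct.of_entire {Q : ℂ → Prop} {E : ℂ → ℂ} (hE : Differentiable ℂ E) :
    IsPoleProduct Q E := ⟨E, 0, hE, by simp, by simp⟩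

theorem IsPoleProduct.inv_sub_pow {Q : ℂ → Prop} {p : ℂ} (hp : Q p) (n : ℕ) :
    IsPoleProduct Q (fun w => ((w - p) ^ n)⁻¹) :=
  ⟨1, Multiset.replicate n p, differentiable_const 1,
    fun q hq => Multiset.eq_of_mem_replicate hq ▸ hp, by ext w; simp⟩

theorem IsPoleProduct.zpow_sub {Q : ℂ → Prop} {p : ℂ} (hp : Q p) (n : ℤ) :
    IsPoleProduct Q (fun w => (w - p) ^ n) := by
  obtain ⟨n, rfl | rfl⟩ := n.eq_nat_or_neg
  · simp only [zpow_natCast]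
    exact .of_entire (by fun_prop)
  · simp only [zpow_neg, zpow_natCast]
    exact .inv_sub_pow hp n

theorem IsPoleProduct.prod {Q : ℂ → Prop} {ι : Type*} (s : Finset ι) (f : ι → ℂ → ℂ)
    (hf : ∀ i ∈ s, IsPoleProduct Q (f i)) : IsPoleProduct Q (fun w => ∏ i ∈ s, f i w) := by
  classical
  induction s using Finset.induction_on with
  | empty => simpa using IsPoleProduct.of_entire (differentiable_const 1)
  | insert i s his ih =>
    simp only [Finset.prod_insert his]
    exact (hf i (Finset.mem_insert_self i s)).mul
      (ih fun j hj => hf j (Finset.mem_insert_of_mem hj))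

theorem IsPoleProduct.symbol {Q : ℂ → Prop} (α β : ℕ → ℝ) (γ : ℝ) (t₁ t₂ : ℕ) (t₃ : ℝ≥0)
    (hα : ∀ j ∈ Finset.Icc 1 t₁, α j ≠ 0 → Q (((α j)⁻¹ : ℝ) : ℂ)) :
    IsPoleProduct Q (symbol α β γ t₁ t₂ t₃) := by
  unfold MixedTASEP.symbol
  refine .mul (.mul (.prod _ _ fun j hj => ?_) (.of_entire ?_)) (.of_entire (by fun_prop))
  -- For `α j = 0` the factor is constant and there is no pole to account for.
  · by_cases h0 : α j = 0
    · simp only [h0, Complex.ofReal_zero, zero_mul]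
      exact .of_entire (by fun_prop)
    · have h := (IsPoleProduct.of_entire (Q := Q)
        (differentiable_const ((1 - (α j : ℂ)) * (-(α j : ℂ)⁻¹)))).mul
        (IsPoleProduct.zpow_sub (hα j hj h0) (-1))
      convert h using 2 with w
      have h1 : (α j : ℂ) ≠ 0 := by exact_mod_cast h0
      have h2 : 1 - (α j : ℂ) * w = -(α j : ℂ) * (w - (((α j)⁻¹ : ℝ) : ℂ)) := by
        push_cast
        field_simp
        ring
      rw [h2, zpow_neg_one, div_eq_mul_inv, mul_inv, inv_neg]
      ring
  · exact Differentiable.fun_finsetProd fun j _ => by fun_prop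

/-- In the integral for `F_n(x)` the curve `c` can be replaced by a large circle. -/
theorem entryF_eq_circleIntegral {c : ℝ → ℂ} (hc : IsSimpleLoop c) (hc₀ : Encloses c 0)
    (hc₁ : Encloses c 1) {α β : ℕ → ℝ} {γ : ℝ} {t₁ t₂ : ℕ} {t₃ : ℝ≥0} {R : ℝ} (hR : 1 < R)
    (hα : ∀ j ∈ Finset.Icc 1 t₁, α j ≠ 0 →
      R < (α j)⁻¹ ∧ LeavesOutside c (((α j)⁻¹ : ℝ) : ℂ)) (n x : ℤ) :
    entryF c (symbol α β γ t₁ t₂ t₃) n x =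
      (-1) ^ n / (2 * Real.pi * Complex.I) *
        ∮ w in C(0, R), (1 - w) ^ (-n) / w ^ (x - n + 1) * symbol α β γ t₁ t₂ t₃ w := by
  -- `Q p` is what the comparison of the two curves needs at a pole `p`. It holds at 0 and 1, which
  -- both curves wind around once, and at each `1/α_j`, which both leave outside.
  set Q : ℂ → Prop := fun p => p ∉ c '' Set.Icc 0 1 ∧ p ∉ Metric.sphere (0 : ℂ) R ∧
    contourIntegral c (fun w => (w - p)⁻¹) = ∮ w in C(0, R), (w - p)⁻¹ with hQ
  have hpi : (2 * Real.pi * Complex.I : ℂ) ≠ 0 := Complex.two_pi_I_ne_zero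
  have henc : ∀ p : ℂ, ‖p‖ < R → Encloses c p → Q p := by
    intro p hp hcp
    refine ⟨?_, ?_, ?_⟩
    · rintro ⟨s, hs, rfl⟩
      exact hcp.1 s hs rfl
    · simp only [mem_sphere_iff_norm, sub_zero]
      exact hp.ne
    · rw [circleIntegral.integral_sub_inv_of_mem_ball (by simpa using hp)]
      have := hcp.2
      rw [windingNumber, inv_mul_eq_iff_eq_mul₀ hpi, mul_one] at this
      exact this
  have hout : ∀ j ∈ Finset.Icc 1 t₁, α j ≠ 0 → Q (((α j)⁻¹ : ℝ) : ℂ) := by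
    intro j hj h0
    obtain ⟨h1, h2⟩ := hα j hj h0
    have hnorm : R < ‖(((α j)⁻¹ : ℝ) : ℂ)‖ := by
      rw [Complex.norm_real, Real.norm_eq_abs]
      exact h1.trans_le (le_abs_self _)
    refine ⟨?_, ?_, ?_⟩
    · rintro ⟨s, hs, hs'⟩
      exact h2.1 s hs hs'
    · simp only [mem_sphere_iff_norm, sub_zero]
      exact hnorm.ne'
    · have hne : ∀ w ∈ Metric.closedBall (0 : ℂ) R, w - (((α j)⁻¹ : ℝ) : ℂ) ≠ 0 := by
        intro w hw h3
        rw [sub_eq_zero.1 h3] at hw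
        simp only [mem_closedBall_zero_iff] at hw
        linarith
      rw [Complex.circleIntegral_eq_zero_of_differentiable_on_off_countable (by linarith)
        Set.countable_empty]
      · have := h2.2
        rw [windingNumber, mul_eq_zero] at this
        exact this.resolve_left (inv_ne_zero hpi)
      · exact ContinuousOn.inv₀ (by fun_prop) hne
      · intro w hw
        exact DifferentiableAt.inv (by fun_prop) (hne w (Metric.ball_subset_closedBall hw.1))
  have hgood : IsPoleProduct Q
      (fun w => (1 - w) ^ (-n) / w ^ (x - n + 1) * symbol α β γ t₁ t₂ t₃ w) := by
    refine .mul ?_ (.symbol α β γ t₁ t₂ t₃ hout)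
    have h := ((IsPoleProduct.zpow_sub (henc 1 (by simpa using hR) hc₁) (-n)).mul
      (IsPoleProduct.zpow_sub (henc 0 (by simp; linarith) hc₀) (-(x - n + 1)))).mul
      (.of_entire (differentiable_const ((-1 : ℂ) ^ (-n))))
    convert h using 2 with w
    rw [sub_zero, zpow_neg w, div_eq_mul_inv, ← neg_sub w 1, neg_eq_neg_one_mul, mul_zpow]
    ring
  obtain ⟨E, L, hE, hL, hEL⟩ := hgood
  rw [entryF, hEL]
  congr 1
  exact (isLoopIntegral_contour hc).eq_of_poles (isLoopIntegral_circle (by linarith)) L hL E hE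

/-! ### The entries of the determinant as integrals over large circles -/

/-- The integral defining `F_n(v)`, over the circle of radius `R`. -/
noncomputable def circleF (R : ℝ) (f : ℂ → ℂ) (n v : ℤ) : ℂ :=
  (-1) ^ n / (2 * Real.pi * Complex.I) *
    ∮ w in C(0, R), (1 - w) ^ (-n) / w ^ (v - n + 1) * f w

section circleF

variable {R : ℝ}

theorem ne_zero_of_mem_sphere (hR : 1 < R) {w : ℂ} (hw : w ∈ Metric.sphere (0 : ℂ) R) : w ≠ 0 := by
  rintro rfl
  simp at hw
  linarith

theorem one_sub_ne_zero_of_mem_sphere (hR : 1 < R) {w : ℂ} (hw : w ∈ Metric.sphere (0 : ℂ) R) :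
    1 - w ≠ 0 := by
  intro h
  rw [← sub_eq_zero.1 h] at hw
  simp at hw
  linarith

theorem continuousOn_kernel (hR : 1 < R) {f : ℂ → ℂ}
    (hf : ContinuousOn f (Metric.sphere 0 R)) (n v : ℤ) :
    ContinuousOn (fun w => (1 - w) ^ (-n) / w ^ (v - n + 1) * f w) (Metric.sphere 0 R) := by
  refine ContinuousOn.mul (ContinuousOn.div ?_ ?_ ?_) hf
  · exact ContinuousOn.zpow₀ (by fun_prop) _
      fun w hw => Or.inl (one_sub_ne_zero_of_mem_sphere hR hw)
  · exact ContinuousOn.zpow₀ (by fun_prop) _ fun w hw => Or.inl (ne_zero_of_mem_sphere hR hw)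
  · exact fun w hw => zpow_ne_zero _ (ne_zero_of_mem_sphere hR hw)

theorem kernel_sub_one (hR : 1 < R) {w : ℂ} (hw : w ∈ Metric.sphere (0 : ℂ) R) (n v : ℤ) :
    (1 - w) ^ (-n) / w ^ (v - 1 - n + 1) = w * ((1 - w) ^ (-n) / w ^ (v - n + 1)) := by
  have h0 := ne_zero_of_mem_sphere hR hw
  rw [show v - n + 1 = v - 1 - n + 1 + 1 by ring, zpow_add_one₀ h0 (v - 1 - n + 1), ← div_div,
    mul_div_cancel₀ _ h0]

theorem circleF_linear (hR : 1 < R) {f g : ℂ → ℂ} (hg : ContinuousOn g (Metric.sphere 0 R))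
    (a b : ℂ) (h : ∀ w ∈ Metric.sphere (0 : ℂ) R, f w = a * g w + b * (w * g w)) (n v : ℤ) :
    circleF R f n v = a * circleF R g n v + b * circleF R g n (v - 1) := by
  have h1 : ∮ w in C(0, R), (1 - w) ^ (-n) / w ^ (v - n + 1) * f w =
      ∮ w in C(0, R), (a * ((1 - w) ^ (-n) / w ^ (v - n + 1) * g w) +
        b * ((1 - w) ^ (-n) / w ^ (v - 1 - n + 1) * g w)) := by
    refine circleIntegral.integral_congr (by linarith) fun w hw => ?_
    simp only [h w hw, kernel_sub_one hR hw]
    ring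
  rw [circleF, h1, circleIntegral.integral_add, circleIntegral.integral_const_mul,
    circleIntegral.integral_const_mul, circleF, circleF]
  · ring
  · exact (continuousOn_const.mul (continuousOn_kernel hR hg n v)).circleIntegrable (by linarith)
  · exact (continuousOn_const.mul
      (continuousOn_kernel hR hg n (v - 1))).circleIntegrable (by linarith)

/-- The kernels at `v` and `v - 1` differ by the factor `w`, so their difference carries `1 - w`,
which lowers the index `n`; the sign `(-1)^n` reverses the order of the difference. -/
theorem circleF_sub (hR : 1 < R) {f : ℂ → ℂ} (hf : ContinuousOn f (Metric.sphere 0 R))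
    (n v : ℤ) : circleF R f n (v - 1) - circleF R f n v = circleF R f (n - 1) (v - 1) := by
  have h2 : ∮ w in C(0, R), (1 - w) ^ (-(n - 1)) / w ^ (v - 1 - (n - 1) + 1) * f w =
      ∮ w in C(0, R), ((1 - w) ^ (-n) / w ^ (v - n + 1) * f w -
        (1 - w) ^ (-n) / w ^ (v - 1 - n + 1) * f w) := by
    refine circleIntegral.integral_congr (by linarith) fun w hw => ?_
    have h0 := one_sub_ne_zero_of_mem_sphere hR hw
    rw [kernel_sub_one hR hw n v, show -(n - 1) = -n + 1 by ring, zpow_add_one₀ h0,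
      show v - 1 - (n - 1) + 1 = v - n + 1 by ring]
    field_simp
  rw [circleF, circleF, circleF, h2, circleIntegral.integral_sub]
  · rw [zpow_sub_one₀ (by norm_num : (-1 : ℂ) ≠ 0)]
    ring
  · exact (continuousOn_kernel hR hf n v).circleIntegrable (by linarith)
  · exact (continuousOn_kernel hR hf n (v - 1)).circleIntegrable (by linarith)

/-- On the circle `|w ^ (-v)| = R ^ (-v)`. This gives decay as `v → ∞`, and growth as `v → -∞` slow
enough to be compensated by `α ^ m` when `α R < 1`. -/
theorem circleF_bound (hR : 1 < R) {f : ℂ → ℂ} (hf : ContinuousOn f (Metric.sphere 0 R))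
    (n : ℤ) : ∃ C : ℝ, 0 ≤ C ∧ ∀ v : ℤ, ‖circleF R f n v‖ ≤ C * R ^ (-v) := by
  have hR0 : (0 : ℝ) < R := by linarith
  obtain ⟨B, hB⟩ := (isCompact_sphere (0 : ℂ) R).exists_bound_of_continuousOn
    (continuousOn_kernel hR hf n 0)
  have hB0 : 0 ≤ B := (norm_nonneg (_ : ℂ)).trans (hB (R : ℂ) (by
    simp [abs_of_pos hR0]))
  refine ⟨‖(-1 : ℂ) ^ n / (2 * Real.pi * Complex.I)‖ * (2 * Real.pi * R * B),
    mul_nonneg (norm_nonneg _) (by have := Real.pi_pos; positivity), fun v => ?_⟩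
  rw [circleF, norm_mul, mul_assoc ‖(-1 : ℂ) ^ n / (2 * Real.pi * Complex.I)‖]
  refine mul_le_mul_of_nonneg_left ?_ (norm_nonneg _)
  rw [mul_assoc _ B]
  refine circleIntegral.norm_integral_le_of_norm_le_const hR0.le fun w hw => ?_
  have h0 := ne_zero_of_mem_sphere hR hw
  have h1 : (1 - w) ^ (-n) / w ^ (v - n + 1) * f w =
      (1 - w) ^ (-n) / w ^ (0 - n + 1) * f w * w ^ (-v) := by
    rw [show v - n + 1 = (0 - n + 1) + v by ring, zpow_add₀ h0, zpow_neg w v]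
    field_simp
  rw [h1, norm_mul, norm_zpow w]
  rw [show ‖w‖ = R by simpa using hw]
  exact mul_le_mul_of_nonneg_right (hB w hw) (by positivity)

theorem circleF_one_zero_zero (hR : 1 < R) : circleF R (fun _ => 1) 0 0 = 1 := by
  have h := circleIntegral.integral_sub_inv_of_mem_ball (c := 0) (w := 0) (R := R) (by simp; linarith)
  have hpi : (2 * Real.pi * Complex.I : ℂ) ≠ 0 := Complex.two_pi_I_ne_zero
  simp only [sub_zero] at h
  simp only [circleF, neg_zero, zpow_zero, sub_zero, zero_add, zpow_one, one_div, mul_one, h]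
  exact inv_mul_cancel₀ hpi

theorem circleF_one_zero_of_ne {v : ℤ} (hv : v ≠ 0) : circleF R (fun _ => 1) 0 v = 0 := by
  have h := circleIntegral.integral_sub_zpow_of_ne (n := -(v + 1)) (by omega) 0 0 R
  simp only [sub_zero] at h
  simp only [circleF, neg_zero, zpow_zero, one_div, mul_one, sub_zero, ← zpow_neg, h, mul_zero]

/-- Induction on `n` in both directions from `n = 0` through `circleF_sub`. Upwards, the vanishing
at `n` makes `F_{n+1}` constant on `v > 0`, and the decay of `F` forces the constant to be 0. -/
theorem circleF_one_of_pos (hR : 1 < R) (n : ℤ) {v : ℤ} (hv : 0 < v) :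
    circleF R (fun _ => 1) n v = 0 := by
  have hc : ContinuousOn (fun _ : ℂ => (1 : ℂ)) (Metric.sphere 0 R) := continuousOn_const
  induction n using Int.induction_on generalizing v with
  | zero => exact circleF_one_zero_of_ne hv.ne'
  | succ n ih =>
    have hstep : ∀ v : ℤ, 0 < v → circleF R (fun _ => 1) (n + 1) (v + 1) =
        circleF R (fun _ => 1) (n + 1) v := by
      intro v hv
      have h := circleF_sub hR hc (n + 1) (v + 1)
      simp only [add_sub_cancel_right] at h
      rw [ih hv] at h
      exact (sub_eq_zero.1 h).symm
    have hconst : ∀ m : ℕ, circleF R (fun _ => 1) (n + 1) (v + m) =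
        circleF R (fun _ => 1) (n + 1) v := by
      intro m
      induction m with
      | zero => simp
      | succ m ihm =>
        rw [Nat.cast_succ, ← add_assoc, hstep _ (by omega), ihm]
    obtain ⟨C, _, hC⟩ := circleF_bound hR hc (n + 1)
    have hlim : Filter.Tendsto (fun m : ℕ => C * R ^ (-v) * (R⁻¹) ^ m) Filter.atTop (nhds 0) := by
      simpa using (tendsto_pow_atTop_nhds_zero_of_lt_one (by positivity)
        (inv_lt_one_of_one_lt₀ hR)).const_mul (C * R ^ (-v))
    rw [← norm_le_zero_iff]
    refine ge_of_tendsto' hlim fun m => ?_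
    rw [← hconst m]
    refine (hC (v + m)).trans (le_of_eq ?_)
    rw [neg_add, zpow_add₀ (by linarith), zpow_neg R (m : ℤ), zpow_natCast, inv_pow, mul_assoc]
  | pred n ih =>
    have h := circleF_sub hR hc (-n) (v + 1)
    simp only [add_sub_cancel_right] at h
    rw [← h, ih hv, ih (by omega), sub_zero]

/-- Both exponents in the kernel are then nonnegative, so the integrand is a polynomial. -/
theorem circleF_one_of_lt (hR : 1 < R) {n v : ℤ} (hn : n ≤ 0) (hv : v < n) :
    circleF R (fun _ => 1) n v = 0 := by
  obtain ⟨a, ha⟩ := Int.eq_ofNat_of_zero_le (by omega : 0 ≤ -n)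
  obtain ⟨b, hb⟩ := Int.eq_ofNat_of_zero_le (by omega : 0 ≤ -(v - n + 1))
  have h1 : ∀ w : ℂ, (1 - w) ^ (-n) / w ^ (v - n + 1) * 1 = (1 - w) ^ a * w ^ b := by
    intro w
    rw [mul_one, div_eq_mul_inv, ← zpow_neg, ha, hb, zpow_natCast, zpow_natCast]
  rw [circleF]
  simp only [h1]
  rw [Complex.circleIntegral_eq_zero_of_differentiable_on_off_countable (by linarith)
    Set.countable_empty (by fun_prop) fun w _ => by fun_prop, mul_zero]

end circleF

/-! ### The determinant and its backward equations -/

variable {N : ℕ}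

/-- The determinant `det [F_{j - i}(x_i - z_j)]`, for arbitrary integer vectors `x` and `z`. -/
noncomputable def detF (R : ℝ) (f : ℂ → ℂ) (x z : Fin N → ℤ) : ℂ :=
  Matrix.det (Matrix.of fun i j : Fin N => circleF R f ((j : ℤ) - (i : ℤ)) (x i - z j))

/-- Moving particle `j` by one site onto the site of particle `i = j - 1` does not change the
determinant. -/
theorem detF_update_of_blocked {R : ℝ} (hR : 1 < R) {f : ℂ → ℂ}
    (hf : ContinuousOn f (Metric.sphere 0 R)) (x z : Fin N → ℤ) {i j : Fin N}
    (hij : (i : ℕ) + 1 = j) (h : z i = z j + 1) :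
    detF R f x (Function.update z j (z j + 1)) = detF R f x z := by
  have hne : j ≠ i := by rintro rfl; omega
  -- By `circleF_sub`, column `j` after the move is the old column `j` plus column `i`.
  rw [detF, detF, ← Matrix.det_updateCol_add_self
    (Matrix.of fun i j : Fin N => circleF R f ((j : ℤ) - (i : ℤ)) (x i - z j)) hne]
  congr 1
  ext k l
  by_cases hl : l = j
  · subst hl
    have h1 := circleF_sub hR hf ((l : ℤ) - (k : ℤ)) (x k - z l)
    have h2 : (i : ℤ) - (k : ℤ) = (l : ℤ) - k - 1 := by omega
    simp only [Matrix.of_apply, Function.update_self, Matrix.updateCol_self, h, h2, ← sub_sub]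
    rw [← h1]
    ring
  · simp only [Matrix.of_apply, Matrix.updateCol_ne hl, Function.update_of_ne hl]

/-! ### Summing products and determinants over integer vectors -/

theorem hasSum_mul_prod {ι κ : Type*} (f : ι → ℂ) (g : κ → ℂ) {s t : ℂ} (hf : HasSum f s)
    (hg : HasSum g t) : HasSum (fun q : ι × κ => f q.1 * g q.2) (s * t) :=
  hf.mul hg (summable_mul_of_summable_norm (summable_norm_iff.2 hf.summable)
    (summable_norm_iff.2 hg.summable))

theorem hasSum_pi_prod (f : Fin N → ℤ → ℂ) (s : Fin N → ℂ) (h : ∀ i, HasSum (f i) (s i)) :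
    HasSum (fun z : Fin N → ℤ => ∏ i, f i (z i)) (∏ i, s i) := by
  induction N with
  | zero => simp
  | succ N ih =>
    rw [← (Fin.consEquiv fun _ : Fin (N + 1) => ℤ).hasSum_iff, Fin.prod_univ_succ]
    have h1 := ih (fun i => f i.succ) (fun i => s i.succ) fun i => h i.succ
    have h2 := hasSum_mul_prod (f 0) (fun z : Fin N → ℤ => ∏ i : Fin N, f i.succ (z i))
      (h 0) h1
    refine h2.congr_fun ?_
    intro z
    simp [Fin.prod_univ_succ, Fin.consEquiv]

/-- Column `j` depends on `z j` alone, so every term of the Leibniz expansion is a product of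
one-variable functions and its sum factorises. -/
theorem hasSum_det (g : Fin N → ℤ → ℂ) (A : Fin N → Fin N → ℤ → ℂ) (B : Matrix (Fin N) (Fin N) ℂ)
    (h : ∀ i j, HasSum (fun z => g j z * A i j z) (B i j)) :
    HasSum (fun z : Fin N → ℤ => (∏ j, g j (z j)) * Matrix.det (Matrix.of fun i j => A i j (z j)))
      B.det := by
  simp only [Matrix.det_apply', Finset.mul_sum]
  refine hasSum_sum fun σ _ => ?_
  have h1 := (hasSum_pi_prod (fun j z => g j z * A (σ j) j z) (fun j => B (σ j) j)
    fun j => h (σ j) j).mul_left ((Equiv.Perm.sign σ : ℤ) : ℂ)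
  refine h1.congr_fun fun z => ?_
  simp only [Matrix.of_apply, Finset.prod_mul_distrib]
  ring

/-! ### Geometric steps -/

section geometric

variable {α : ℂ} {u U : ℤ → ℂ}

/-- The terms are `α^m U(a+m) - α^(m+1) U(a+m+1)`: a convergent series minus its own shift. -/
theorem hasSum_geometric_free (hu : ∀ z, (1 - α) * u z = U z - α * U (z + 1)) (a : ℤ)
    (hs : Summable fun m : ℕ => α ^ m * U (a + m)) :
    HasSum (fun z : ℤ => (if a ≤ z then (1 - α) * α ^ (z - a).toNat else 0) * u z) (U a) := by
  have hinj : Function.Injective fun m : ℕ => a + (m : ℤ) := fun m n h => by simpa using h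
  rw [← hinj.hasSum_iff]
  · have h1 := hs.hasSum
    have h2 := (hasSum_nat_add_iff' 1).2 h1
    have h3 := h1.sub h2
    simp only [Finset.range_one, Finset.sum_singleton, pow_zero, one_mul, Nat.cast_zero, add_zero,
      sub_sub_cancel] at h3
    refine h3.congr_fun fun m => ?_
    simp only [Function.comp, le_add_iff_nonneg_right, Nat.cast_nonneg, if_true,
      add_sub_cancel_left, Int.toNat_natCast]
    rw [mul_right_comm, hu]
    push_cast
    rw [← add_assoc]
    ring
  · intro z hz
    rw [if_neg, zero_mul]
    intro h
    exact hz ⟨(z - a).toNat, by simp only; omega⟩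

/-- The same telescoping stops at `b - 1`, where the weight has no factor `1 - α`; the second
summand is the resulting boundary term. -/
theorem hasSum_geometric_blocked (hu : ∀ z, (1 - α) * u z = U z - α * U (z + 1)) {a b : ℤ}
    (hab : a < b) :
    HasSum (fun z : ℤ => (if a ≤ z then
        if z + 1 < b then (1 - α) * α ^ (z - a).toNat
        else if z + 1 = b then α ^ (z - a).toNat else 0
      else 0) * u z) (U a + α ^ (b - 1 - a).toNat * (u (b - 1) - U (b - 1))) := by
  have hinj : Function.Injective fun m : ℕ => a + (m : ℤ) := fun m n h => by simpa using h
  obtain ⟨M, hM⟩ := Int.eq_ofNat_of_zero_le (by omega : 0 ≤ b - 1 - a)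
  rw [← hinj.hasSum_iff]
  · have hsum : U a + α ^ (b - 1 - a).toNat * (u (b - 1) - U (b - 1)) =
        ∑ m ∈ Finset.range (M + 1), ((fun z : ℤ => (if a ≤ z then
          if z + 1 < b then (1 - α) * α ^ (z - a).toNat
          else if z + 1 = b then α ^ (z - a).toNat else 0
        else 0) * u z) ∘ fun m : ℕ => a + (m : ℤ)) m := by
      have h1 : ∀ m ∈ Finset.range M, ((fun z : ℤ => (if a ≤ z then
          if z + 1 < b then (1 - α) * α ^ (z - a).toNat
          else if z + 1 = b then α ^ (z - a).toNat else 0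
        else 0) * u z) ∘ fun m : ℕ => a + (m : ℤ)) m =
          α ^ m * U (a + m) - α ^ (m + 1) * U (a + (m + 1 : ℕ)) := by
        intro m hm
        have := Finset.mem_range.1 hm
        simp only [Function.comp]
        rw [if_pos (by omega), if_pos (by omega), add_sub_cancel_left, Int.toNat_natCast,
          mul_right_comm, hu]
        push_cast
        rw [← add_assoc]
        ring
      rw [Finset.sum_range_succ, Finset.sum_congr rfl h1,
        Finset.sum_range_sub' (fun m : ℕ => α ^ m * U (a + m))]
      simp only [Function.comp]
      rw [if_pos (by omega), if_neg (by omega), if_pos (by omega), add_sub_cancel_left,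
        Int.toNat_natCast, hM, Int.toNat_natCast, show b - 1 = a + M by omega]
      simp
      ring
    rw [hsum]
    refine hasSum_sum_of_ne_finset_zero fun m hm => ?_
    rw [Finset.mem_range] at hm
    simp only [Function.comp]
    rw [if_pos (by omega), if_neg (by omega), if_neg (by omega), zero_mul]
  · intro z hz
    rw [if_neg, zero_mul]
    intro h
    exact hz ⟨(z - a).toNat, by simp only; omega⟩

end geometric

theorem front_zero (x : Config (N + 1)) : front x 0 = ⊤ := by simp [front]

theorem front_succ (x : Config (N + 1)) (i : Fin N) :
    front x i.succ = ((x.1 i.castSucc : ℤ) : WithTop ℤ) := by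
  simp [front]
  rfl

/-- The factor of `geometricStep` that belongs to particle `i`, as a function of its new position. -/
noncomputable def geometricWeight (α : ℝ) (a : Config N) (i : Fin N) (z : ℤ) : ℝ :=
  if a.1 i ≤ z then
    if ((z + 1 : ℤ) : WithTop ℤ) < front a i then (1 - α) * α ^ (z - a.1 i).toNat
    else if ((z + 1 : ℤ) : WithTop ℤ) = front a i then α ^ (z - a.1 i).toNat
    else 0
  else 0

theorem geometricWeight_zero (α : ℝ) (a : Config (N + 1)) (z : ℤ) :
    ((geometricWeight α a 0 z : ℝ) : ℂ) =
      if a.1 0 ≤ z then (1 - (α : ℂ)) * (α : ℂ) ^ (z - a.1 0).toNat else 0 := by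
  simp only [geometricWeight, front_zero, WithTop.coe_lt_top, if_true]
  split_ifs <;> push_cast <;> rfl

theorem geometricWeight_succ (α : ℝ) (a : Config (N + 1)) (i : Fin N) (z : ℤ) :
    ((geometricWeight α a i.succ z : ℝ) : ℂ) =
      if a.1 i.succ ≤ z then
        if z + 1 < a.1 i.castSucc then (1 - (α : ℂ)) * (α : ℂ) ^ (z - a.1 i.succ).toNat
        else if z + 1 = a.1 i.castSucc then (α : ℂ) ^ (z - a.1 i.succ).toNat else 0
      else 0 := by
  simp only [geometricWeight, front_succ, WithTop.coe_lt_coe, WithTop.coe_inj]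
  split_ifs <;> push_cast <;> rfl

/-- A particle never reaches the old position of its predecessor, which itself never moves back.
Sums over configurations may therefore be taken over all integer vectors, where they factorise. -/
theorem geometricWeight_support (α : ℝ) (a : Config (N + 1)) (z : Fin (N + 1) → ℤ)
    (h : ∏ i, geometricWeight α a i (z i) ≠ 0) : StrictAnti z := by
  rw [Fin.strictAnti_iff_succ_lt]
  intro i
  have h1 := Finset.prod_ne_zero_iff.1 h i.castSucc (Finset.mem_univ _)
  have h2 := Finset.prod_ne_zero_iff.1 h i.succ (Finset.mem_univ _)
  have h3 : a.1 i.castSucc ≤ z i.castSucc := by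
    by_contra h4
    exact h1 (by rw [geometricWeight, if_neg h4])
  have h5 : z i.succ + 1 ≤ a.1 i.castSucc := by
    by_contra h4
    refine h2 ?_
    simp only [geometricWeight, front_succ, WithTop.coe_lt_coe, WithTop.coe_inj]
    rw [if_neg (by omega : ¬ (z i.succ + 1 < a.1 i.castSucc)),
      if_neg (by omega : ¬ (z i.succ + 1 = a.1 i.castSucc))]
    simp
  omega

theorem hasSum_config_iff {w : (Fin N → ℤ) → ℂ} {s : ℂ} (h : ∀ z, w z ≠ 0 → StrictAnti z) :
    HasSum (fun z : Config N => w z.1) s ↔ HasSum w s :=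
  hasSum_subtype_iff_of_support_subset (s := {z : Fin N → ℤ | StrictAnti z}) h

theorem hasSum_geometricStep_one {α : ℝ} (hα : α ∈ Set.Ico (0 : ℝ) 1) (a : Config (N + 1)) :
    HasSum (fun z : Config (N + 1) => ((geometricStep α a z : ℝ) : ℂ)) 1 := by
  have hu : ∀ z : ℤ, (1 - (α : ℂ)) * (fun _ : ℤ => (1 : ℂ)) z =
      (fun _ : ℤ => (1 : ℂ)) z - α * (fun _ : ℤ => (1 : ℂ)) (z + 1) := fun _ => by ring
  have h1 : HasSum (fun z : Fin (N + 1) → ℤ =>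
      ∏ i, (((geometricWeight α a i (z i) : ℝ) : ℂ))) (∏ _i : Fin (N + 1), 1) := by
    refine hasSum_pi_prod (fun i z => ((geometricWeight α a i z : ℝ) : ℂ)) (fun _ => 1) fun i => ?_
    cases i using Fin.cases
    · have hs : Summable fun m : ℕ => (α : ℂ) ^ m * (fun _ : ℤ => (1 : ℂ)) (a.1 0 + m) := by
        simp only [mul_one]
        refine summable_geometric_of_norm_lt_one ?_
        rw [Complex.norm_real, Real.norm_eq_abs, abs_of_nonneg hα.1]
        exact hα.2
      simpa only [geometricWeight_zero, mul_one] using hasSum_geometric_free hu (a.1 0) hs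
    · rename_i i
      simpa only [geometricWeight_succ, mul_one, sub_self, mul_zero, add_zero] using
        hasSum_geometric_blocked hu (a.2 (Fin.castSucc_lt_succ (i := i)))
  rw [Finset.prod_const_one] at h1
  simp only [← Complex.ofReal_prod] at h1
  exact (hasSum_config_iff (w := fun z => ((∏ i, geometricWeight α a i (z i) : ℝ) : ℂ))
    fun z hz => geometricWeight_support α a z (by exact_mod_cast hz)).2 h1

theorem hasSum_geometricStep_detF {R : ℝ} (hR : 1 < R) {α : ℝ} (hα : α ∈ Set.Ico (0 : ℝ) 1)
    (hαR : α * R < 1) {f g : ℂ → ℂ} (hf : ContinuousOn f (Metric.sphere 0 R))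
    (hg : ∀ w ∈ Metric.sphere (0 : ℂ) R, g w = f w * ((1 - (α : ℂ)) / (1 - α * w)))
    (x : Fin (N + 1) → ℤ) (a : Config (N + 1)) :
    HasSum (fun z : Config (N + 1) => ((geometricStep α a z : ℝ) : ℂ) * detF R f x z.1)
      (detF R g x a.1) := by
  have hα1 : (1 - (α : ℂ)) ≠ 0 := by
    have : (1 : ℝ) - α ≠ 0 := by linarith [hα.2]
    exact_mod_cast this
  have hne : ∀ w ∈ Metric.sphere (0 : ℂ) R, 1 - (α : ℂ) * w ≠ 0 := by
    intro w hw h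
    have h1 : ‖(α : ℂ) * w‖ = 1 := by rw [← sub_eq_zero.1 h, norm_one]
    rw [norm_mul, Complex.norm_real, Real.norm_eq_abs, abs_of_nonneg hα.1,
      show ‖w‖ = R by simpa using hw] at h1
    linarith
  have hgc : ContinuousOn g (Metric.sphere 0 R) := by
    refine ContinuousOn.congr (hf.mul (ContinuousOn.div continuousOn_const (by fun_prop) hne)) hg
  have hfg : ∀ n v : ℤ, (1 - (α : ℂ)) * circleF R f n v =
      circleF R g n v - α * circleF R g n (v - 1) := by
    intro n v
    rw [circleF_linear hR hgc (1 - (α : ℂ))⁻¹ (-(α : ℂ) * (1 - (α : ℂ))⁻¹) (f := f)]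
    · field_simp
      ring
    · intro w hw
      rw [hg w hw]
      have := hne w hw
      field_simp
      ring
  have hu : ∀ i j : Fin (N + 1), ∀ z : ℤ,
      (1 - (α : ℂ)) * (fun z : ℤ => circleF R f ((j : ℤ) - (i : ℤ)) (x i - z)) z =
      (fun z : ℤ => circleF R g ((j : ℤ) - (i : ℤ)) (x i - z)) z -
        α * (fun z : ℤ => circleF R g ((j : ℤ) - (i : ℤ)) (x i - z)) (z + 1) := by
    intro i j z
    simp only [hfg, ← sub_sub]
  -- With `u`, `U` the entries for `f`, `g` and `b` the old position of the predecessor, `(1 - α)(u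
  -- - U)(b - 1) = α (U(b - 1) - U(b))`. By `circleF_sub` this is `-α` times the entry of the
  -- preceding column, so the boundary term is `-κ` times that entry.
  set κ : Fin N → ℂ := fun i =>
    (α : ℂ) ^ (a.1 i.castSucc - 1 - a.1 i.succ).toNat * (α / (1 - α)) with hκ
  set B : Matrix (Fin (N + 1)) (Fin (N + 1)) ℂ := Matrix.of fun i j =>
    Fin.cases (circleF R g ((0 : ℤ) - (i : ℤ)) (x i - a.1 0))
      (fun j : Fin N => circleF R g ((j.succ : ℕ) - (i : ℤ)) (x i - a.1 j.succ) -
        κ j * circleF R g ((j : ℤ) - (i : ℤ)) (x i - a.1 j.castSucc)) j with hB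
  have hdet : detF R g x a.1 = B.det := by
    refine Matrix.det_eq_of_forall_col_eq_smul_add_pred κ (fun i => ?_) fun i j => ?_
    · simp [hB]
    · simp [hB]
  have h1 : HasSum (fun z : Fin (N + 1) → ℤ =>
      (∏ i, (((geometricWeight α a i (z i) : ℝ) : ℂ))) * detF R f x z) B.det := by
    refine hasSum_det (fun j z => ((geometricWeight α a j z : ℝ) : ℂ))
      (fun i j z => circleF R f ((j : ℤ) - (i : ℤ)) (x i - z)) B fun i j => ?_
    revert j
    refine Fin.cases ?_ fun j => ?_
    · have hs : Summable fun m : ℕ => (α : ℂ) ^ m *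
          (fun z : ℤ => circleF R g (((0 : Fin (N + 1)) : ℤ) - (i : ℤ)) (x i - z)) (a.1 0 + m) := by
        obtain ⟨C, hC0, hC⟩ := circleF_bound hR hgc (((0 : Fin (N + 1)) : ℤ) - (i : ℤ))
        refine Summable.of_norm_bounded (g := fun m : ℕ => (C * R ^ (-(x i - a.1 0))) * (α * R) ^ m)
          ((summable_geometric_of_lt_one (mul_nonneg hα.1 (by linarith)) hαR).mul_left _) fun m => ?_
        rw [norm_mul, norm_pow, Complex.norm_real, Real.norm_eq_abs, abs_of_nonneg hα.1]
        refine (mul_le_mul_of_nonneg_left (hC _) (pow_nonneg hα.1 m)).trans (le_of_eq ?_)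
        rw [show -(x i - (a.1 0 + m)) = -(x i - a.1 0) + m by ring, zpow_add₀ (by linarith),
          zpow_natCast, mul_pow]
        ring
      simpa [geometricWeight_zero, hB] using hasSum_geometric_free (hu i 0) (a.1 0) hs
    · have h2 := hasSum_geometric_blocked (hu i j.succ) (a.2 (Fin.castSucc_lt_succ (i := j)))
      simp only [← geometricWeight_succ] at h2
      convert h2 using 1
      have h3 := hfg ((j.succ : ℤ) - (i : ℤ)) (x i - (a.1 j.castSucc - 1))
      have h4 := circleF_sub hR hgc ((j.succ : ℤ) - (i : ℤ)) (x i - (a.1 j.castSucc - 1))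
      rw [show x i - (a.1 j.castSucc - 1) - 1 = x i - a.1 j.castSucc by ring] at h3 h4
      have h5 : ((j.succ : ℕ) : ℤ) - (i : ℤ) - 1 = (j : ℤ) - i := by
        simp only [Fin.val_succ]; push_cast; ring
      rw [h5] at h4
      simp only [hB, hκ, Matrix.of_apply, Fin.cases_succ]
      rw [← h4, sub_eq_add_neg]
      congr 1
      rw [mul_assoc, ← mul_neg]
      congr 1
      field_simp
      linear_combination -h3
  simp only [← Complex.ofReal_prod] at h1
  rw [hdet]
  exact (hasSum_config_iff
    (w := fun z => ((∏ i, geometricWeight α a i (z i) : ℝ) : ℂ) * detF R f x z)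
    fun z hz => geometricWeight_support α a z (by
      exact_mod_cast left_ne_zero_of_mul hz)).2 h1

/-! ### The initial value -/

/-- For `z = x` the matrix is lower triangular with unit diagonal. Otherwise look at the first `j`
with `z_j ≠ x_j`: if `z_j < x_j` there is a block of zeros too large for a nonzero determinant, and
if `z_j > x_j` column `j` vanishes. -/
theorem detF_one {R : ℝ} (hR : 1 < R) (x z : Config N) :
    detF R (fun _ => 1) x.1 z.1 = if z = x then 1 else 0 := by
  split_ifs with h
  · subst h
    rw [detF, Matrix.det_of_isLowerTriangular]
    · simp [circleF_one_zero_zero hR]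
    · intro i j hij
      have := z.2 (show i < j from hij)
      exact circleF_one_of_pos hR _ (by omega)
  · have hne : ∃ j, z.1 j ≠ x.1 j := by
      by_contra hall
      push Not at hall
      exact h (Subtype.ext (funext hall))
    obtain ⟨j, hj, hmin⟩ : ∃ j, z.1 j ≠ x.1 j ∧ ∀ i < j, z.1 i = x.1 i := by
      obtain ⟨j, hj⟩ := exists_minimal_of_wellFoundedLT _ hne
      refine ⟨j, hj.1, fun i hi => ?_⟩
      by_contra h'
      exact absurd (hj.2 h' hi.le) (not_le.2 hi)
    rcases lt_or_gt_of_ne hj with hlt | hgt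
    · have hzero : ∀ i l : Fin N, i ≤ j → i < l ∨ j ≤ l →
          circleF R (fun _ => 1) ((l : ℤ) - (i : ℤ)) (x.1 i - z.1 l) = 0 := by
        intro i l hij hl
        refine circleF_one_of_pos hR _ ?_
        have hxi := x.2.antitone hij
        rcases lt_or_ge l j with hlj | hlj
        · have := hmin l hlj
          have := x.2 (hl.resolve_right (not_le.2 hlj))
          omega
        · have := z.2.antitone hlj
          omega
      rw [detF, Matrix.det_apply']
      refine Finset.sum_eq_zero fun σ _ => ?_
      suffices ∃ l, σ l ≤ j ∧ j ≤ l by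
        obtain ⟨l, h1, h2⟩ := this
        rw [Finset.prod_eq_zero (Finset.mem_univ l), mul_zero]
        simp only [Matrix.of_apply]
        exact hzero _ _ h1 (Or.inr h2)
      by_contra hno
      push Not at hno
      -- A permutation avoiding the zero block (rows up to `j`, columns from `j` on) would inject
      -- `Iic j` into `Iio j` through its inverse.
      have hcard : (Finset.Iic j).card ≤ (Finset.Iio j).card := by
        refine Finset.card_le_card_of_injOn (fun i => σ.symm i) (fun i hi => ?_)
          σ.symm.injective.injOn
        have hi' : i ≤ j := by simpa using hi
        simp only [Finset.coe_Iio, Set.mem_Iio]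
        by_contra h'
        exact absurd (hno (σ.symm i) (by simpa using hi')) h'
      simp at hcard
    · rw [detF]
      refine Matrix.det_eq_zero_of_column_eq_zero j fun i => ?_
      simp only [Matrix.of_apply]
      rcases lt_or_ge i j with hij | hij
      · have h1 := hmin i hij
        have h2 := z.2 hij
        exact circleF_one_of_pos hR _ (by omega)
      · refine circleF_one_of_lt hR (by have : (j : ℕ) ≤ i := hij; omega) ?_
        -- Strict decrease gives `x_i - z_j < j - i`, the range in which `circleF_one_of_lt`
        -- applies.
        have hgap : ∀ k : ℕ, ∀ i : Fin N, (i : ℕ) = j + k → x.1 i + k ≤ x.1 j := by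
          intro k
          induction k with
          | zero => intro i hi; rw [Fin.ext (by simpa using hi) (a := i) (b := j)]; simp
          | succ k ih =>
            intro i hi
            have h1 := ih ⟨j + k, by omega⟩ rfl
            have h2 := x.2 (show (⟨j + k, by omega⟩ : Fin N) < i from by
              rw [Fin.lt_def]; simp only; omega)
            push_cast
            omega
        have hij' : (j : ℕ) ≤ i := hij
        have := hgap ((i : ℕ) - j) i (by omega)
        push_cast [hij'] at this
        omega

/-! ### Bernoulli steps -/

/-- The position in front of particle `i`, for an arbitrary integer vector. -/
def frontOf (z : Fin N → ℤ) (i : Fin N) : WithTop ℤ :=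
  if h : (i : ℕ) = 0 then ⊤ else ((z ⟨(i : ℕ) - 1, by omega⟩ : ℤ) : WithTop ℤ)

/-- The law of a free Bernoulli jump from `a`. -/
noncomputable def freeWeight (p : ℝ) (a z : ℤ) : ℝ :=
  if z = a then 1 - p else if z = a + 1 then p else 0

/-- The law of a Bernoulli jump that takes the exclusion into account. -/
noncomputable def blockedWeight (p : ℝ) (a z : Fin N → ℤ) (i : Fin N) : ℝ :=
  if ((a i + 1 : ℤ) : WithTop ℤ) < frontOf z i then freeWeight p (a i) (z i)
  else if z i = a i then 1 else 0

/-- All vectors that arise from `a` when some particles move by one site. -/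
def unitBox (a : Fin N → ℤ) : Finset (Fin N → ℤ) := Fintype.piFinset fun i => {a i, a i + 1}

theorem mem_unitBox {a z : Fin N → ℤ} : z ∈ unitBox a ↔ ∀ i, z i = a i ∨ z i = a i + 1 := by
  simp [unitBox]

theorem frontOf_update_self (z : Fin N → ℤ) (j : Fin N) (b : ℤ) :
    frontOf (Function.update z j b) j = frontOf z j := by
  unfold frontOf
  split_ifs with h
  · rfl
  · rw [Function.update_of_ne]
    intro h1
    have := congrArg Fin.val h1
    simp only at this
    omega

theorem frontOf_update_of_lt (z : Fin N → ℤ) {i j : Fin N} (hij : i < j) (b : ℤ) :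
    frontOf (Function.update z j b) i = frontOf z i := by
  unfold frontOf
  split_ifs with h
  · rfl
  · rw [Function.update_of_ne]
    intro h1
    have hval : (i : ℕ) - 1 = j := congrArg Fin.val h1
    have hlt : (i : ℕ) < j := hij
    omega

/-- Functions of an integer vector that do not change when a particle moves onto the site of its
predecessor. -/
def IsReflected (Φ : (Fin N → ℤ) → ℂ) : Prop :=
  ∀ (z : Fin N → ℤ) (i j : Fin N), (i : ℕ) + 1 = j → z i = z j + 1 →
    Φ (Function.update z j (z j + 1)) = Φ z

/-- Particles behind `j` already jump freely, so only particle `j` sees `z_j`. If it is blocked,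
reflection makes `Φ` equal at `z_j = a_j` and `z_j = a_j + 1`, and either law has total mass 1 on
these two sites. The intermediate vectors may put two particles on one site, hence `Φ` on all
integer vectors. -/
theorem sum_unitBox_succ {Φ : (Fin N → ℤ) → ℂ} (hΦ : IsReflected Φ) (p : ℝ) {a : Fin N → ℤ}
    (ha : StrictAnti a) (j : Fin N) :
    ∑ z ∈ unitBox a, ((∏ i : Fin N, if (i : ℕ) < j + 1 then blockedWeight p a z i
        else freeWeight p (a i) (z i) : ℝ) : ℂ) * Φ z =
      ∑ z ∈ unitBox a, ((∏ i : Fin N, if (i : ℕ) < j then blockedWeight p a z i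
        else freeWeight p (a i) (z i) : ℝ) : ℂ) * Φ z := by
  set W : (Fin N → ℤ) → ℝ := fun z => ∏ i ∈ Finset.univ.erase j,
    if (i : ℕ) < j then blockedWeight p a z i else freeWeight p (a i) (z i) with hW
  have hWu : ∀ z b, W (Function.update z j b) = W z := by
    intro z b
    refine Finset.prod_congr rfl fun i hi => ?_
    have hne := Finset.ne_of_mem_erase hi
    split_ifs with h
    · simp only [blockedWeight, frontOf_update_of_lt z (Fin.lt_def.2 h), Function.update_of_ne hne]
    · rw [Function.update_of_ne hne]
  have h1 : ∀ z, (∏ i : Fin N, if (i : ℕ) < j + 1 then blockedWeight p a z i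
      else freeWeight p (a i) (z i)) = blockedWeight p a z j * W z := by
    intro z
    rw [← Finset.mul_prod_erase _ _ (Finset.mem_univ j), if_pos (Nat.lt_succ_self _)]
    congr 1
    refine Finset.prod_congr rfl fun i hi => ?_
    have hne : (i : ℕ) ≠ j := fun h => Finset.ne_of_mem_erase hi (Fin.ext h)
    simp only [show (i : ℕ) < j + 1 ↔ (i : ℕ) < j by omega]
  have h2 : ∀ z, (∏ i : Fin N, if (i : ℕ) < j then blockedWeight p a z i
      else freeWeight p (a i) (z i)) = freeWeight p (a j) (z j) * W z := by
    intro z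
    rw [← Finset.mul_prod_erase _ _ (Finset.mem_univ j), if_neg (lt_irrefl _)]
  simp only [h1, h2]
  rw [← sub_eq_zero, ← Finset.sum_sub_distrib]
  have hpair : ∀ z ∈ unitBox a, z j = a j →
      ((blockedWeight p a z j * W z : ℝ) : ℂ) * Φ z -
        ((freeWeight p (a j) (z j) * W z : ℝ) : ℂ) * Φ z +
      (((blockedWeight p a (Function.update z j (a j + 1)) j *
          W (Function.update z j (a j + 1)) : ℝ) : ℂ) * Φ (Function.update z j (a j + 1)) -
        ((freeWeight p (a j) (Function.update z j (a j + 1) j) *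
          W (Function.update z j (a j + 1)) : ℝ) : ℂ) * Φ (Function.update z j (a j + 1))) = 0 := by
    intro z hz hzj
    rw [hWu, blockedWeight, blockedWeight, frontOf_update_self, Function.update_self]
    by_cases hfree : ((a j + 1 : ℤ) : WithTop ℤ) < frontOf z j
    · simp only [if_pos hfree]
      ring
    · have hj0 : (j : ℕ) ≠ 0 := by
        intro h0
        simp [frontOf, h0] at hfree
      set i : Fin N := ⟨(j : ℕ) - 1, by omega⟩ with hi
      have hij : (i : ℕ) + 1 = j := by simp only [hi]; omega
      have hzi : z i = z j + 1 := by
        have hfree' : ¬ (a j + 1 < z i) := by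
          rwa [frontOf, dif_neg hj0, WithTop.coe_lt_coe] at hfree
        have h3 := ha (show i < j from by rw [Fin.lt_def]; omega)
        have h4 := (mem_unitBox.1 hz) i
        omega
      have h5 := hΦ z i j hij hzi
      rw [hzj] at h5
      rw [h5, if_neg hfree, if_neg hfree, hzj]
      simp only [freeWeight, if_true]
      rw [if_neg (by omega), if_neg (by omega)]
      push_cast
      ring
  -- This involution exchanges the two possible values `a j` and `a j + 1` of `z j`.
  refine Finset.sum_involution (fun z _ => Function.update z j (2 * a j + 1 - z j)) ?_ ?_ ?_ ?_
  · intro z hz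
    rcases (mem_unitBox.1 hz) j with h | h
    · have := hpair z hz h
      rw [show 2 * a j + 1 - z j = a j + 1 by omega]
      exact this
    · have hz' : Function.update z j (a j) ∈ unitBox a := by
        rw [mem_unitBox] at hz ⊢
        intro i
        by_cases hi : i = j
        · subst hi; simp
        · rw [Function.update_of_ne hi]; exact hz i
      have := hpair _ hz' (Function.update_self ..)
      rw [Function.update_idem, ← h, Function.update_eq_self] at this
      rw [show 2 * a j + 1 - z j = a j by omega, add_comm]
      exact this
  · intro z _ _ h
    have := congrFun h j
    rw [Function.update_self] at this
    omega
  · intro z hz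
    rw [mem_unitBox] at hz ⊢
    intro i
    by_cases hi : i = j
    · subst hi
      have := hz i
      rw [Function.update_self]
      omega
    · rw [Function.update_of_ne hi]; exact hz i
  · intro z _
    simp

theorem blockedWeight_support (p : ℝ) {a : Fin N → ℤ} (ha : StrictAnti a) {z : Fin N → ℤ}
    (h : ∏ i, blockedWeight p a z i ≠ 0) : z ∈ unitBox a ∧ StrictAnti z := by
  have h1 : ∀ i, (z i = a i ∨ z i = a i + 1) ∧
      (z i = a i ∨ ((a i + 1 : ℤ) : WithTop ℤ) < frontOf z i) := by
    intro i
    have hi := Finset.prod_ne_zero_iff.1 h i (Finset.mem_univ _)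
    unfold blockedWeight freeWeight at hi
    split_ifs at hi <;> simp_all
  refine ⟨mem_unitBox.2 fun i => (h1 i).1, ?_⟩
  cases N with
  | zero => exact fun i => i.elim0
  | succ N =>
    rw [Fin.strictAnti_iff_succ_lt]
    intro i
    have h2 := (h1 i.castSucc).1
    have h3 := h1 i.succ
    have h4 := ha (Fin.castSucc_lt_succ (i := i))
    rcases h3.2 with h5 | h5
    · omega
    · have h6 : frontOf z i.succ = ((z i.castSucc : ℤ) : WithTop ℤ) := by
        simp [frontOf]
        rfl
      rw [h6, WithTop.coe_lt_coe] at h5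
      omega

theorem hasSum_bernoulliStep {Φ : (Fin N → ℤ) → ℂ} (hΦ : IsReflected Φ) (p : ℝ) (a : Config N) :
    HasSum (fun z : Config N => ((bernoulliStep p a z : ℝ) : ℂ) * Φ z.1)
      (∑ z ∈ unitBox a.1, ((∏ i, freeWeight p (a.1 i) (z i) : ℝ) : ℂ) * Φ z) := by
  have hk : ∀ k : ℕ, k ≤ N → ∑ z ∈ unitBox a.1,
      ((∏ i : Fin N, if (i : ℕ) < k then blockedWeight p a.1 z i
        else freeWeight p (a.1 i) (z i) : ℝ) : ℂ) * Φ z =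
      ∑ z ∈ unitBox a.1, ((∏ i, freeWeight p (a.1 i) (z i) : ℝ) : ℂ) * Φ z := by
    intro k
    induction k with
    | zero => intro _; simp
    | succ k ih =>
      intro hkN
      rw [← ih (by omega)]
      exact sum_unitBox_succ hΦ p a.2 ⟨k, hkN⟩
  have hN := hk N le_rfl
  simp only [Fin.is_lt, if_true] at hN
  rw [← hN]
  refine (hasSum_config_iff
    (w := fun z => ((∏ i, blockedWeight p a.1 z i : ℝ) : ℂ) * Φ z) fun z hz => ?_).2 ?_
  · exact (blockedWeight_support p a.2 (by exact_mod_cast left_ne_zero_of_mul hz)).2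
  · refine hasSum_sum_of_ne_finset_zero fun z hz => ?_
    by_contra h
    exact hz (blockedWeight_support p a.2 (by exact_mod_cast left_ne_zero_of_mul h)).1

theorem hasSum_freeWeight (p : ℝ) (a : ℤ) (u : ℤ → ℂ) :
    HasSum (fun z => ((freeWeight p a z : ℝ) : ℂ) * u z) ((1 - p) * u a + p * u (a + 1)) := by
  have h : HasSum (fun z => ((freeWeight p a z : ℝ) : ℂ) * u z)
      (∑ z ∈ {a, a + 1}, ((freeWeight p a z : ℝ) : ℂ) * u z) := by
    refine hasSum_sum_of_ne_finset_zero fun z hz => ?_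
    simp only [Finset.mem_insert, Finset.mem_singleton, not_or] at hz
    simp [freeWeight, hz.1, hz.2]
  rw [Finset.sum_pair (by omega)] at h
  simpa [freeWeight] using h

theorem sum_unitBox_eq {w : (Fin N → ℤ) → ℂ} {p : ℝ} {a : Fin N → ℤ} {s : ℂ}
    (h : HasSum (fun z => ((∏ i, freeWeight p (a i) (z i) : ℝ) : ℂ) * w z) s) :
    ∑ z ∈ unitBox a, ((∏ i, freeWeight p (a i) (z i) : ℝ) : ℂ) * w z = s := by
  refine HasSum.unique (hasSum_sum_of_ne_finset_zero fun z hz => ?_) h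
  by_contra h0
  refine hz (mem_unitBox.2 fun i => ?_)
  have h1 : ∏ i, freeWeight p (a i) (z i) ≠ 0 := by exact_mod_cast left_ne_zero_of_mul h0
  have hi := Finset.prod_ne_zero_iff.1 h1 i (Finset.mem_univ _)
  unfold freeWeight at hi
  split_ifs at hi <;> simp_all

theorem hasSum_bernoulliStep_one (p : ℝ) (a : Config N) :
    HasSum (fun z : Config N => ((bernoulliStep p a z : ℝ) : ℂ)) 1 := by
  have h := hasSum_bernoulliStep (Φ := fun _ => 1) (fun _ _ _ _ _ => rfl) p a
  rw [sum_unitBox_eq (s := 1)] at h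
  · simpa using h
  · have h1 := hasSum_pi_prod (fun i z => ((freeWeight p (a.1 i) z : ℝ) : ℂ)) (fun _ => 1) fun i => by
      simpa using hasSum_freeWeight p (a.1 i) fun _ => 1
    simpa using h1

theorem isReflected_detF {R : ℝ} (hR : 1 < R) {f : ℂ → ℂ}
    (hf : ContinuousOn f (Metric.sphere 0 R)) (x : Fin N → ℤ) : IsReflected (detF R f x) :=
  fun z _ _ hij h => detF_update_of_blocked hR hf x z hij h

theorem hasSum_bernoulliStep_detF {R : ℝ} (hR : 1 < R) (p : ℝ) {f g : ℂ → ℂ}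
    (hf : ContinuousOn f (Metric.sphere 0 R))
    (hg : ∀ w ∈ Metric.sphere (0 : ℂ) R, g w = f w * (1 - p + p * w))
    (x : Fin N → ℤ) (a : Config N) :
    HasSum (fun z : Config N => ((bernoulliStep p a z : ℝ) : ℂ) * detF R f x z.1)
      (detF R g x a.1) := by
  have h := hasSum_bernoulliStep (isReflected_detF hR hf x) p a
  rwa [sum_unitBox_eq (s := detF R g x a.1)] at h
  have h1 := hasSum_det (fun j z => ((freeWeight p (a.1 j) z : ℝ) : ℂ))
    (fun i j z => circleF R f ((j : ℤ) - (i : ℤ)) (x i - z))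
    (Matrix.of fun i j : Fin N => circleF R g ((j : ℤ) - (i : ℤ)) (x i - a.1 j)) fun i j => by
      rw [Matrix.of_apply, circleF_linear hR hf (1 - p) p (f := g), sub_sub]
      · exact hasSum_freeWeight p (a.1 j) _
      · intro w hw
        rw [hg w hw]
        ring
  simp only [← Complex.ofReal_prod] at h1
  exact h1

/-! ### The continuous time TASEP -/

/-- The symbol of the continuous time TASEP, at complex time `t`. -/
noncomputable def expSymbol (γ : ℝ) (t w : ℂ) : ℂ := Complex.exp (γ * t * (w - 1))

theorem continuous_expSymbol (γ : ℝ) (t : ℂ) : Continuous (expSymbol γ t) := by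
  unfold expSymbol
  fun_prop

theorem hasDerivAt_circleF_expSymbol {R : ℝ} (hR : 1 < R) (γ : ℝ) (n v : ℤ) (t : ℂ) :
    HasDerivAt (fun t => circleF R (expSymbol γ t) n v)
      (γ * (circleF R (expSymbol γ t) n (v - 1) - circleF R (expSymbol γ t) n v)) t := by
  have hR0 : 0 ≤ R := by linarith
  have hsph : ∀ θ, circleMap 0 R θ ∈ Metric.sphere (0 : ℂ) R := circleMap_mem_sphere 0 hR0
  set k : ℂ → ℂ := fun w => (1 - w) ^ (-n) / w ^ (v - n + 1) with hk
  have hkc : Continuous fun θ => k (circleMap 0 R θ) := by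
    have h := continuousOn_kernel hR (f := fun _ => 1) continuousOn_const n v
    simp only [mul_one] at h
    exact h.comp_continuous (continuous_circleMap 0 R) hsph
  have hdc : Continuous (deriv (circleMap 0 R)) := by
    have : deriv (circleMap 0 R) = fun θ => circleMap 0 R θ * Complex.I := by
      ext θ
      simp
    rw [this]
    exact (continuous_circleMap 0 R).mul continuous_const
  have hF : ∀ s : ℂ, Continuous fun θ =>
      deriv (circleMap 0 R) θ • (k (circleMap 0 R θ) * expSymbol γ s (circleMap 0 R θ)) := fun s =>
    hdc.smul (hkc.mul ((continuous_expSymbol γ s).comp (continuous_circleMap 0 R)))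
  have hF' : Continuous fun θ => deriv (circleMap 0 R) θ • (k (circleMap 0 R θ) *
      (γ * (circleMap 0 R θ - 1) * expSymbol γ t (circleMap 0 R θ))) :=
    hdc.smul (hkc.mul ((continuous_const.mul ((continuous_circleMap 0 R).sub continuous_const)).mul
      ((continuous_expSymbol γ t).comp (continuous_circleMap 0 R))))
  -- The dominating function comes from `‖s‖ ≤ ‖t‖ + 1` on the unit ball around `t` and `‖w - 1‖ ≤ R
  -- + 1` on the circle.
  have hb : Continuous fun θ => ‖deriv (circleMap 0 R) θ‖ * (‖k (circleMap 0 R θ)‖ *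
      (|γ| * (R + 1) * Real.exp (|γ| * (‖t‖ + 1) * (R + 1)))) :=
    hdc.norm.mul (hkc.norm.mul continuous_const)
  have key := intervalIntegral.hasDerivAt_integral_of_dominated_loc_of_deriv_le
    (μ := volume) (a := 0) (b := 2 * Real.pi)
    (F := fun s θ => deriv (circleMap 0 R) θ •
      (k (circleMap 0 R θ) * expSymbol γ s (circleMap 0 R θ)))
    (F' := fun s θ => deriv (circleMap 0 R) θ • (k (circleMap 0 R θ) *
      (γ * (circleMap 0 R θ - 1) * expSymbol γ s (circleMap 0 R θ))))
    (x₀ := t) (Metric.ball_mem_nhds t one_pos)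
    (Filter.Eventually.of_forall fun s => (hF s).aestronglyMeasurable)
    ((hF t).intervalIntegrable _ _) hF'.aestronglyMeasurable
    (bound := fun θ => ‖deriv (circleMap 0 R) θ‖ * (‖k (circleMap 0 R θ)‖ *
      (|γ| * (R + 1) * Real.exp (|γ| * (‖t‖ + 1) * (R + 1)))))
    (Filter.Eventually.of_forall fun θ _ s hs => by
      have hs' : ‖s‖ ≤ ‖t‖ + 1 := by
        have h1 := norm_sub_norm_le s t
        have h2 : ‖s - t‖ < 1 := by simpa [dist_eq_norm] using hs
        linarith
      have hw : ‖circleMap 0 R θ - 1‖ ≤ R + 1 := by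
        refine (norm_sub_le _ _).trans ?_
        rw [show ‖circleMap 0 R θ‖ = R by simpa using hsph θ, norm_one]
      have he : ‖expSymbol γ s (circleMap 0 R θ)‖ ≤ Real.exp (|γ| * (‖t‖ + 1) * (R + 1)) := by
        refine (Complex.norm_exp_le_exp_norm _).trans (Real.exp_le_exp.2 ?_)
        rw [norm_mul, norm_mul, Complex.norm_real, Real.norm_eq_abs]
        gcongr
      rw [norm_smul, norm_mul, norm_mul, norm_mul, Complex.norm_real, Real.norm_eq_abs]
      gcongr)
    (hb.intervalIntegrable _ _)
    (Filter.Eventually.of_forall fun θ _ s _ => by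
      have h1 : HasDerivAt (fun s : ℂ => expSymbol γ s (circleMap 0 R θ))
          (γ * (circleMap 0 R θ - 1) * expSymbol γ s (circleMap 0 R θ)) s := by
        have h2 := (((hasDerivAt_id s).const_mul (γ : ℂ)).mul_const (circleMap 0 R θ - 1)).cexp
        simp only [id, mul_one] at h2
        refine HasDerivAt.congr_deriv h2 ?_
        rw [expSymbol]
        ring
      exact (h1.const_mul (k (circleMap 0 R θ))).const_smul (deriv (circleMap 0 R) θ))
  have hlin := circleF_linear hR (f := fun w => γ * (w - 1) * expSymbol γ t w)
    (continuous_expSymbol γ t).continuousOn (-γ) γ (fun w _ => by ring) n v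
  have hres := key.2.const_mul ((-1 : ℂ) ^ n / (2 * Real.pi * Complex.I))
  refine HasDerivAt.congr_deriv hres ?_
  rw [mul_sub, sub_eq_neg_add, ← neg_mul, ← hlin]
  rfl

theorem hasDerivAt_detF_expSymbol {R : ℝ} (hR : 1 < R) (γ : ℝ) (x : Fin N → ℤ) (y : Fin N → ℤ)
    (t : ℂ) :
    HasDerivAt (fun t => detF R (expSymbol γ t) x y)
      (γ * ∑ j : Fin N, (detF R (expSymbol γ t) x (Function.update y j (y j + 1)) -
        detF R (expSymbol γ t) x y)) t := by
  simp only [detF, Matrix.det_apply', Matrix.of_apply]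
  have h1 : ∀ σ : Equiv.Perm (Fin N), HasDerivAt
      (fun t => ((Equiv.Perm.sign σ : ℤ) : ℂ) *
        ∏ i : Fin N, circleF R (expSymbol γ t) ((i : ℤ) - (σ i : ℤ)) (x (σ i) - y i)) _ t := fun σ =>
    (HasDerivAt.fun_finsetProd fun (i : Fin N) (_ : i ∈ Finset.univ) =>
      hasDerivAt_circleF_expSymbol hR γ ((i : ℤ) - (σ i : ℤ)) (x (σ i) - y i) t).const_mul _
  refine HasDerivAt.congr_deriv (HasDerivAt.fun_sum fun σ _ => h1 σ) ?_
  simp only [← Finset.sum_sub_distrib]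
  rw [Finset.sum_comm, Finset.mul_sum]
  refine Finset.sum_congr rfl fun σ _ => ?_
  rw [Finset.mul_sum, Finset.mul_sum]
  refine Finset.sum_congr rfl fun j _ => ?_
  have herase : ∏ i ∈ Finset.univ.erase j, circleF R (expSymbol γ t) ((i : ℤ) - (σ i : ℤ))
        (x (σ i) - Function.update y j (y j + 1) i) =
      ∏ i ∈ Finset.univ.erase j, circleF R (expSymbol γ t) ((i : ℤ) - (σ i : ℤ))
        (x (σ i) - y i) := Finset.prod_congr rfl fun i hi => by
    rw [Function.update_of_ne (Finset.ne_of_mem_erase hi)]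
  rw [← Finset.mul_prod_erase _ _ (Finset.mem_univ j), ← Finset.mul_prod_erase _
    (fun i : Fin N => circleF R (expSymbol γ t) ((i : ℤ) - (σ i : ℤ)) (x (σ i) - y i)) (Finset.mem_univ j),
    herase, Function.update_self, ← sub_sub]
  simp only [smul_eq_mul]
  ring

theorem detF_hop {R : ℝ} (hR : 1 < R) {f : ℂ → ℂ} (hf : ContinuousOn f (Metric.sphere 0 R))
    (x : Fin N → ℤ) (y : Config N) (j : Fin N) :
    detF R f x (hop y j).1 = detF R f x (Function.update y.1 j (y.1 j + 1)) := by
  unfold hop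
  split_ifs with h
  · rfl
  · push Not at h
    obtain ⟨i, hi⟩ := h
    -- The occupant of the neighbouring site is the direct predecessor: a particle strictly between
    -- the two labels would need a site strictly between adjacent sites.
    have hij : (i : ℕ) + 1 = j := by
      have h1 : i < j := y.2.lt_iff_gt.1 (by omega)
      by_contra hne
      have h1' : (i : ℕ) < j := h1
      have h2 := y.2 (show i < ⟨(i : ℕ) + 1, by omega⟩ from by rw [Fin.lt_def]; simp)
      have h3 := y.2 (show (⟨(i : ℕ) + 1, by omega⟩ : Fin N) < j from by
        rw [Fin.lt_def]; simp only; omega)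
      omega
    exact (detF_update_of_blocked hR hf x y.1 hij hi).symm

/-- The formal generator, acting on all complex functions. -/
noncomputable def formalGenerator (γ : ℝ) (g : Config N → ℂ) (y : Config N) : ℂ :=
  γ * ∑ i : Fin N, (g (hop y i) - g y)

theorem hasDerivAt_iterate_formalGenerator {γ : ℝ} {D : ℂ → Config N → ℂ}
    (hD : ∀ y t, HasDerivAt (fun t => D t y) (formalGenerator γ (D t) y) t) (n : ℕ) (y : Config N)
    (t : ℂ) : HasDerivAt (fun t => (formalGenerator γ)^[n] (D t) y)
      ((formalGenerator γ)^[n + 1] (D t) y) t := by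
  induction n generalizing y t with
  | zero => exact hD y t
  | succ n ih =>
    simp only [Function.iterate_succ_apply' (formalGenerator γ)] at ih ⊢
    exact (HasDerivAt.fun_sum fun i _ => (ih (hop y i) t).sub (ih y t)).const_mul _

/-- A solution of the backward equation for complex time is entire, and its `n`-th derivative is the
`n`-th iterate of the generator. Taylor expansion at 0 thus determines it from its initial value,
with no bound in `y`. -/
theorem hasSum_formalGenerator {γ : ℝ} {D : ℂ → Config N → ℂ}
    (hD : ∀ y t, HasDerivAt (fun t => D t y) (formalGenerator γ (D t) y) t) (y : Config N) (t : ℂ) :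
    HasSum (fun n : ℕ => (n.factorial : ℂ)⁻¹ * (t ^ n * (formalGenerator γ)^[n] (D 0) y)) (D t y) := by
  have h := Complex.hasSum_taylorSeries_of_entire (f := fun t => D t y)
    (fun t => (hD y t).differentiableAt) 0 t
  have hit : ∀ n : ℕ, iteratedDeriv n (fun t => D t y) =
      fun t => (formalGenerator γ)^[n] (D t) y := by
    intro n
    induction n with
    | zero => simp
    | succ n ih =>
      rw [iteratedDeriv_succ, ih]
      ext t
      exact (hasDerivAt_iterate_formalGenerator hD n y t).deriv
  simpa only [hit, sub_zero, smul_eq_mul] using h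

theorem generator_apply (γ : ℝ) (f : Config N →ᵇ ℝ) (y : Config N) :
    generator N γ f y = γ * ∑ i : Fin N, (f (hop y i) - f y) := rfl

theorem generator_iterate_apply (γ : ℝ) (n : ℕ) (f : Config N →ᵇ ℝ) (y : Config N) :
    ((((generator N γ)^[n] f) y : ℝ) : ℂ) = (formalGenerator γ)^[n] (fun y => ((f y : ℝ) : ℂ)) y := by
  induction n generalizing y with
  | zero => rfl
  | succ n ih =>
    rw [Function.iterate_succ_apply', Function.iterate_succ_apply', generator_apply,
      formalGenerator]
    push_cast
    simp only [ih]

set_option maxSynthPendingDepth 3 in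
theorem hasSum_continuousTransition (γ t : ℝ) (y x : Config N) :
    HasSum (fun n : ℕ => (n.factorial : ℝ)⁻¹ * (t ^ n * (generator N γ ^ n) (indicatorFun x) y))
      (continuousTransition γ t y x) := by
  have h := NormedSpace.exp_series_hasSum_exp' (𝕂 := ℝ) (t • generator N γ)
  have h1 := h.mapL (ContinuousLinearMap.apply ℝ (Config N →ᵇ ℝ) (indicatorFun x))
  have h2 := h1.mapL (BoundedContinuousFunction.evalCLM ℝ y)
  refine h2.congr_fun fun n => ?_
  simp [smul_pow]

-- A bound uniform in both configurations is all that reassociating the sums requires of this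
-- kernel; the operator norm provides it.
set_option maxSynthPendingDepth 3 in
theorem continuousTransition_bound (γ t : ℝ) :
    ∃ C : ℝ, ∀ y x : Config N, |continuousTransition γ t y x| ≤ C := by
  refine ⟨‖NormedSpace.exp (t • generator N γ)‖, fun y x => ?_⟩
  refine ((NormedSpace.exp (t • generator N γ) (indicatorFun x)).norm_coe_le_norm y).trans ?_
  refine (ContinuousLinearMap.le_opNorm _ _).trans ?_
  refine mul_le_of_le_one_right (norm_nonneg _) ?_
  refine (BoundedContinuousFunction.norm_le zero_le_one).2 fun z => ?_
  simp only [indicatorFun, BoundedContinuousFunction.coe_ofNormedAddCommGroupDiscrete]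
  split_ifs <;> simp

theorem continuousTransition_eq_detF {R : ℝ} (hR : 1 < R) (γ t : ℝ) (y x : Config N) :
    ((continuousTransition γ t y x : ℝ) : ℂ) = detF R (expSymbol γ t) x.1 y.1 := by
  have hD : ∀ (y : Config N) (t : ℂ), HasDerivAt (fun t => detF R (expSymbol γ t) x.1 y.1)
      (formalGenerator γ (fun y => detF R (expSymbol γ t) x.1 y.1) y) t := by
    intro y t
    simp only [formalGenerator, detF_hop hR (continuous_expSymbol γ t).continuousOn]
    exact hasDerivAt_detF_expSymbol hR γ x.1 y.1 t
  have h1 := hasSum_formalGenerator (D := fun t y => detF R (expSymbol γ t) x.1 y.1) hD y t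
  have h0 : (fun y : Config N => detF R (expSymbol γ 0) x.1 y.1) =
      fun y => ((indicatorFun x y : ℝ) : ℂ) := by
    ext y
    have : expSymbol γ 0 = fun _ => 1 := by
      ext w
      simp [expSymbol]
    rw [this, detF_one hR x y]
    simp only [indicatorFun, BoundedContinuousFunction.coe_ofNormedAddCommGroupDiscrete]
    split_ifs <;> simp
  rw [h0] at h1
  have h2 := Complex.hasSum_ofReal.2 (hasSum_continuousTransition γ t y x)
  refine HasSum.unique (h2.congr_fun fun n => ?_) h1
  push_cast
  rw [generator_iterate_apply]

/-! ### Substochastic kernels and the Chapman-Kolmogorov composition -/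

/-- Substochastic kernels on configurations. -/
structure IsSubstochastic (p : Config N → Config N → ℝ) : Prop where
  nonneg : ∀ y z, 0 ≤ p y z
  summable : ∀ y, Summable (p y)
  tsum_le_one : ∀ y, ∑' z, p y z ≤ 1

theorem IsSubstochastic.summable_prod {p q : Config N → Config N → ℝ} (hp : IsSubstochastic p)
    (hq : IsSubstochastic q) (y : Config N) :
    Summable fun zw : Config N × Config N => p y zw.1 * q zw.1 zw.2 := by
  refine (summable_prod_of_nonneg fun zw => mul_nonneg (hp.nonneg _ _) (hq.nonneg _ _)).2
    ⟨fun z => show Summable fun w => p y z * q z w from (hq.summable z).mul_left (p y z), ?_⟩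
  simp only [tsum_mul_left]
  exact Summable.of_nonneg_of_le (f := p y)
    (fun z => mul_nonneg (hp.nonneg _ _) (tsum_nonneg (hq.nonneg z)))
    (fun z => mul_le_of_le_one_right (hp.nonneg _ _) (hq.tsum_le_one z)) (hp.summable y)

theorem IsSubstochastic.compose {p q : Config N → Config N → ℝ} (hp : IsSubstochastic p)
    (hq : IsSubstochastic q) : IsSubstochastic (compose p q) where
  nonneg y x := tsum_nonneg fun z => mul_nonneg (hp.nonneg _ _) (hq.nonneg _ _)
  summable y := (hp.summable_prod hq y).prod_symm.prod
  tsum_le_one y := by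
    have h : ∑' x, MixedTASEP.compose p q y x = ∑' z, ∑' x, p y z * q z x :=
      Summable.tsum_comm (f := fun z x => p y z * q z x) (hp.summable_prod hq y)
    rw [h]
    simp only [tsum_mul_left]
    refine le_trans (Summable.tsum_le_tsum
      (fun z => mul_le_of_le_one_right (hp.nonneg _ _) (hq.tsum_le_one z)) ?_ (hp.summable y))
      (hp.tsum_le_one y)
    exact Summable.of_nonneg_of_le (f := p y)
      (fun z => mul_nonneg (hp.nonneg _ _) (tsum_nonneg (hq.nonneg z)))
      (fun z => mul_le_of_le_one_right (hp.nonneg _ _) (hq.tsum_le_one z)) (hp.summable y)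

/-- Fubini: the double series is dominated by `C` times the summable product of `p` and `q`. -/
theorem compose_assoc {p q r : Config N → Config N → ℝ} (hp : IsSubstochastic p)
    (hq : IsSubstochastic q) {C : ℝ} {x : Config N} (hr : ∀ z, |r z x| ≤ C) (y : Config N) :
    compose (compose p q) r y x = compose p (compose q r) y x := by
  have hs : Summable fun zw : Config N × Config N => p y zw.1 * q zw.1 zw.2 * r zw.2 x := by
    refine Summable.of_norm_bounded ((hp.summable_prod hq y).mul_right C) fun zw => ?_
    rw [norm_mul, Real.norm_of_nonneg (mul_nonneg (hp.nonneg _ _) (hq.nonneg _ _))]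
    exact mul_le_mul_of_nonneg_left (hr _) (mul_nonneg (hp.nonneg _ _) (hq.nonneg _ _))
  simp only [compose, ← tsum_mul_right, ← tsum_mul_left]
  rw [Summable.tsum_comm (f := fun z w => p y z * q z w * r w x) hs]
  simp only [mul_assoc]

theorem abs_compose_le {p r : Config N → Config N → ℝ} (hp : IsSubstochastic p) {C : ℝ}
    {x : Config N} (hr : ∀ z, |r z x| ≤ C) (y : Config N) : |compose p r y x| ≤ C := by
  have hC : 0 ≤ C := (abs_nonneg _).trans (hr y)
  have h := tsum_of_norm_bounded (f := fun z => p y z * r z x) ((hp.summable y).mul_right C).hasSum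
    fun z => by
      rw [norm_mul, Real.norm_of_nonneg (hp.nonneg _ _)]
      exact mul_le_mul_of_nonneg_left (hr z) (hp.nonneg _ _)
  rw [tsum_mul_right] at h
  exact h.trans (mul_le_of_le_one_left hC (hp.tsum_le_one y))

theorem isSubstochastic_id : IsSubstochastic fun y x : Config N => if y = x then (1 : ℝ) else 0 where
  nonneg y z := by split_ifs <;> norm_num
  summable y := (hasSum_ite_eq y (1 : ℝ)).summable.congr fun z => by simp only [eq_comm]
  tsum_le_one y := by simp

theorem compose_id_left (r : Config N → Config N → ℝ) (y x : Config N) :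
    compose (fun y x : Config N => if y = x then (1 : ℝ) else 0) r y x = r y x := by
  simp [compose]

theorem IsSubstochastic.of_hasSum {p : Config N → Config N → ℝ} (h0 : ∀ y z, 0 ≤ p y z)
    (h1 : ∀ y, HasSum (fun z => ((p y z : ℝ) : ℂ)) 1) : IsSubstochastic p := by
  have h : ∀ y, HasSum (p y) 1 := fun y => Complex.hasSum_ofReal.1 (by simpa using h1 y)
  exact ⟨h0, fun y => (h y).summable, fun y => (h y).tsum_eq.le⟩

theorem geometricStep_one (a b : Config (N + 1)) : geometricStep 1 a b = 0 := by
  refine Finset.prod_eq_zero (Finset.mem_univ 0) ?_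
  simp [front_zero]

theorem isSubstochastic_geometricStep {α : ℝ} (hα : α ∈ Set.Icc (0 : ℝ) 1) :
    IsSubstochastic (geometricStep (N := N + 1) α) := by
  -- For `α = 1` the step is the zero kernel, which is why kernels are only required to be
  -- substochastic.
  rcases hα.2.eq_or_lt with rfl | h1
  · exact ⟨fun y z => by rw [geometricStep_one], fun y => by
      simpa only [funext fun z => geometricStep_one y z] using summable_zero, fun y => by
      simp [geometricStep_one]⟩
  · refine .of_hasSum (fun y z => Finset.prod_nonneg fun i _ => ?_)
      fun y => hasSum_geometricStep_one ⟨hα.1, h1⟩ y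
    have := hα.1
    have : 0 ≤ 1 - α := by linarith
    split_ifs <;> positivity

theorem isSubstochastic_bernoulliStep {p : ℝ} (hp : p ∈ Set.Icc (0 : ℝ) 1) :
    IsSubstochastic (bernoulliStep (N := N) p) := by
  refine .of_hasSum (fun y z => Finset.prod_nonneg fun i _ => ?_)
    fun y => hasSum_bernoulliStep_one p y
  have := hp.1
  have : 0 ≤ 1 - p := by linarith [hp.2]
  split_ifs <;> positivity

theorem isSubstochastic_geometricTransition {α : ℕ → ℝ} {k : ℕ}
    (hα : ∀ j ∈ Finset.Icc 1 k, α j ∈ Set.Icc (0 : ℝ) 1) :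
    IsSubstochastic (geometricTransition (N := N + 1) α k) := by
  induction k with
  | zero => exact isSubstochastic_id
  | succ k ih =>
    exact (ih fun j hj => hα j (Finset.Icc_subset_Icc_right (Nat.le_succ k) hj)).compose
      (isSubstochastic_geometricStep (hα _ (by simp)))

theorem hopping_mem_Icc {b : ℝ} (hb : 0 ≤ b) : b / (1 + b) ∈ Set.Icc (0 : ℝ) 1 :=
  ⟨by positivity, by rw [div_le_one (by positivity)]; linarith⟩

theorem isSubstochastic_bernoulliTransition {β : ℕ → ℝ} {t₁ k : ℕ}
    (hβ : ∀ j ∈ Finset.Icc (t₁ + 1) (t₁ + k), 0 ≤ β j) :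
    IsSubstochastic (bernoulliTransition (N := N) β t₁ k) := by
  induction k with
  | zero => exact isSubstochastic_id
  | succ k ih =>
    refine (ih fun j hj => hβ j ?_).compose
      (isSubstochastic_bernoulliStep (hopping_mem_Icc (hβ _ ?_)))
    · simp only [Finset.mem_Icc] at hj ⊢; omega
    · simp only [Finset.mem_Icc]; omega

/-! ### Determinantal form of the composed kernels -/

/-- The last step is absorbed into `q` and its factor into `f`; the induction hypothesis, for
general `q` and `f`, then handles the earlier steps. -/
theorem compose_geometricTransition_eq_detF {R : ℝ} (hR : 1 < R) {α : ℕ → ℝ} {k : ℕ}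
    (hα : ∀ j ∈ Finset.Icc 1 k, α j ∈ Set.Ico (0 : ℝ) 1 ∧ α j * R < 1)
    {q : Config (N + 1) → Config (N + 1) → ℝ} {C : ℝ} {x : Config (N + 1)}
    (hq : ∀ z, |q z x| ≤ C) {f : ℂ → ℂ} (hf : ContinuousOn f (Metric.sphere 0 R))
    (hqf : ∀ z, ((q z x : ℝ) : ℂ) = detF R f x.1 z.1) (y : Config (N + 1)) :
    ((compose (geometricTransition α k) q y x : ℝ) : ℂ) =
      detF R (fun w => (∏ j ∈ Finset.Icc 1 k, (1 - (α j : ℂ)) / (1 - (α j : ℂ) * w)) * f w)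
        x.1 y.1 := by
  induction k generalizing q f with
  | zero =>
    simp only [geometricTransition, compose_id_left, hqf]
    simp
  | succ k ih =>
    have hαk : ∀ j ∈ Finset.Icc 1 k, α j ∈ Set.Ico (0 : ℝ) 1 ∧ α j * R < 1 := fun j hj =>
      hα j (Finset.Icc_subset_Icc_right (Nat.le_succ k) hj)
    obtain ⟨hk1, hk2⟩ := hα (k + 1) (by simp)
    have hstep := isSubstochastic_geometricStep (N := N) (Set.Ico_subset_Icc_self hk1)
    rw [geometricTransition, compose_assoc (isSubstochastic_geometricTransition fun j hj =>
      Set.Ico_subset_Icc_self (hαk j hj).1) hstep hq]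
    have hne : ∀ w ∈ Metric.sphere (0 : ℂ) R, 1 - (α (k + 1) : ℂ) * w ≠ 0 := by
      intro w hw h
      have h1 : ‖(α (k + 1) : ℂ) * w‖ = 1 := by rw [← sub_eq_zero.1 h, norm_one]
      rw [norm_mul, Complex.norm_real, Real.norm_eq_abs, abs_of_nonneg hk1.1,
        show ‖w‖ = R by simpa using hw] at h1
      linarith
    rw [ih hαk (abs_compose_le hstep hq)
      (f := fun w => f w * ((1 - (α (k + 1) : ℂ)) / (1 - (α (k + 1) : ℂ) * w)))]
    · congr 1
      ext w
      rw [Finset.prod_Icc_succ_top (by omega)]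
      ring
    · exact hf.mul (ContinuousOn.div continuousOn_const (by fun_prop) hne)
    · intro z
      rw [compose, Complex.ofReal_tsum]
      simp only [Complex.ofReal_mul, hqf]
      exact (hasSum_geometricStep_detF hR hk1 hk2 hf (fun _ _ => rfl) x.1 z).tsum_eq

theorem compose_bernoulliTransition_eq_detF {R : ℝ} (hR : 1 < R) {β : ℕ → ℝ} {t₁ k : ℕ}
    (hβ : ∀ j ∈ Finset.Icc (t₁ + 1) (t₁ + k), 0 ≤ β j)
    {q : Config N → Config N → ℝ} {C : ℝ} {x : Config N}
    (hq : ∀ z, |q z x| ≤ C) {f : ℂ → ℂ} (hf : ContinuousOn f (Metric.sphere 0 R))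
    (hqf : ∀ z, ((q z x : ℝ) : ℂ) = detF R f x.1 z.1) (y : Config N) :
    ((compose (bernoulliTransition β t₁ k) q y x : ℝ) : ℂ) =
      detF R (fun w => (∏ j ∈ Finset.Icc (t₁ + 1) (t₁ + k),
        (1 + (β j : ℂ) * w) / (1 + (β j : ℂ))) * f w) x.1 y.1 := by
  induction k generalizing q f with
  | zero =>
    simp only [bernoulliTransition, compose_id_left, hqf]
    simp
  | succ k ih =>
    have hβk : ∀ j ∈ Finset.Icc (t₁ + 1) (t₁ + k), 0 ≤ β j := fun j hj =>
      hβ j (by simp only [Finset.mem_Icc] at hj ⊢; omega)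
    have hb : 0 ≤ β (t₁ + k + 1) := hβ _ (by simp only [Finset.mem_Icc]; omega)
    have hstep := isSubstochastic_bernoulliStep (N := N) (hopping_mem_Icc hb)
    rw [bernoulliTransition, compose_assoc (isSubstochastic_bernoulliTransition hβk) hstep hq]
    have hb1 : (1 + (β (t₁ + k + 1) : ℂ)) ≠ 0 := by
      have : 1 + β (t₁ + k + 1) ≠ 0 := by positivity
      exact_mod_cast this
    rw [ih hβk (abs_compose_le hstep hq)
      (f := fun w => f w * ((1 + (β (t₁ + k + 1) : ℂ) * w) / (1 + (β (t₁ + k + 1) : ℂ))))]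
    · congr 1
      ext w
      rw [← add_assoc t₁ k 1, Finset.prod_Icc_succ_top (by omega)]
      ring
    · exact hf.mul (by fun_prop)
    · intro z
      rw [compose, Complex.ofReal_tsum]
      simp only [Complex.ofReal_mul, hqf]
      refine (hasSum_bernoulliStep_detF hR _ hf (fun w _ => ?_) x.1 z).tsum_eq
      congr 1
      push_cast
      field_simp
      ring

/-! ### The mixed kernel and the general contour -/

theorem mixedTransition_eq_compose {α β : ℕ → ℝ} {γ : ℝ} {t₁ t₂ : ℕ} {t₃ : ℝ≥0}
    (hα : ∀ j ∈ Finset.Icc 1 t₁, α j ∈ Set.Icc (0 : ℝ) 1)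
    (hβ : ∀ j ∈ Finset.Icc (t₁ + 1) (t₁ + t₂), 0 ≤ β j) (y x : Config (N + 1)) :
    mixedTransition α β γ t₁ t₂ t₃ y x = compose (geometricTransition α t₁)
      (compose (bernoulliTransition β t₁ t₂) (continuousTransition γ t₃)) y x := by
  obtain ⟨C, hC⟩ := continuousTransition_bound (N := N + 1) γ t₃
  exact compose_assoc (isSubstochastic_geometricTransition hα)
    (isSubstochastic_bernoulliTransition hβ) (fun z => hC z x) y

theorem mixedTransition_eq_detF {R : ℝ} (hR : 1 < R) {α β : ℕ → ℝ} {γ : ℝ} {t₁ t₂ : ℕ} {t₃ : ℝ≥0}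
    (hα : ∀ j ∈ Finset.Icc 1 t₁, α j ∈ Set.Ico (0 : ℝ) 1 ∧ α j * R < 1)
    (hβ : ∀ j ∈ Finset.Icc (t₁ + 1) (t₁ + t₂), 0 ≤ β j) (y x : Config (N + 1)) :
    ((mixedTransition α β γ t₁ t₂ t₃ y x : ℝ) : ℂ) =
      detF R (symbol α β γ t₁ t₂ t₃) x.1 y.1 := by
  obtain ⟨C, hC⟩ := continuousTransition_bound (N := N + 1) γ t₃
  have hexp := (continuous_expSymbol γ (t₃ : ℝ)).continuousOn (s := Metric.sphere (0 : ℂ) R)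
  rw [mixedTransition_eq_compose (fun j hj => Set.Ico_subset_Icc_self (hα j hj).1) hβ,
    compose_geometricTransition_eq_detF hR hα
      (abs_compose_le (isSubstochastic_bernoulliTransition hβ) fun z => hC z x) ?_
      (compose_bernoulliTransition_eq_detF hR hβ (fun z => hC z x) hexp
        fun z => continuousTransition_eq_detF hR γ t₃ z x)]
  · congr 1
    ext w
    rw [symbol, expSymbol, ← mul_assoc]
  · exact ContinuousOn.mul (by fun_prop) hexp

theorem mixedTransition_eq_zero {α β : ℕ → ℝ} {γ : ℝ} {t₁ t₂ : ℕ} {t₃ : ℝ≥0} {j : ℕ}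
    (hj : j ∈ Finset.Icc 1 t₁) (hαj : α j = 1) (y x : Config (N + 1)) :
    mixedTransition α β γ t₁ t₂ t₃ y x = 0 := by
  have hgeo : ∀ k, j ≤ k → ∀ y x : Config (N + 1), geometricTransition α k y x = 0 := by
    intro k hk
    induction k, hk using Nat.le_induction with
    | base =>
      intro y x
      obtain ⟨i, rfl⟩ : ∃ i, j = i + 1 := ⟨j - 1, by have := (Finset.mem_Icc.1 hj).1; omega⟩
      simp [geometricTransition, compose, hαj, geometricStep_one]
    | succ k _ ih =>
      intro y x
      simp [geometricTransition, compose, ih]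
  simp [mixedTransition, compose, hgeo t₁ (Finset.mem_Icc.1 hj).2]

theorem symbol_eq_zero {α β : ℕ → ℝ} {γ : ℝ} {t₁ t₂ : ℕ} {t₃ : ℝ≥0} {j : ℕ}
    (hj : j ∈ Finset.Icc 1 t₁) (hαj : α j = 1) (w : ℂ) : symbol α β γ t₁ t₂ t₃ w = 0 := by
  rw [symbol, Finset.prod_eq_zero hj (by simp [hαj]), zero_mul, zero_mul]

theorem exists_radius {α : ℕ → ℝ} {s : Finset ℕ} (hα : ∀ j ∈ s, α j ∈ Set.Ico (0 : ℝ) 1) :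
    ∃ R : ℝ, 1 < R ∧ ∀ j ∈ s, α j * R < 1 := by
  have h : ∀ j ∈ s, ∀ᶠ R in nhdsWithin (1 : ℝ) (Set.Ioi 1), α j * R < 1 := by
    intro j hj
    have h1 : Filter.Tendsto (fun R : ℝ => α j * R) (nhds 1) (nhds (α j * 1)) :=
      (continuous_const.mul continuous_id).tendsto 1
    exact (h1.mono_left nhdsWithin_le_nhds).eventually_lt_const (by simpa using (hα j hj).2)
  obtain ⟨R, hR, hR1⟩ := (((Filter.eventually_all_finset s).2 h).and self_mem_nhdsWithin).exists
  exact ⟨R, hR1, hR⟩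

theorem mixedTransition_eq_det {t₁ t₂ : ℕ} {t₃ : ℝ≥0} {α β : ℕ → ℝ} {γ : ℝ}
    (hα : ∀ j ∈ Finset.Icc 1 t₁, α j ∈ Set.Icc (0 : ℝ) 1)
    (hβ : ∀ j ∈ Finset.Icc (t₁ + 1) (t₁ + t₂), 0 ≤ β j)
    {c : ℝ → ℂ} (hc : IsSimpleLoop c) (hc₀ : Encloses c 0) (hc₁ : Encloses c 1)
    (hcα : ∀ j ∈ Finset.Icc 1 t₁, 0 < α j → α j < 1 → LeavesOutside c (((α j)⁻¹ : ℝ) : ℂ))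
    (x y : Config (N + 1)) :
    ((mixedTransition α β γ t₁ t₂ t₃ y x : ℝ) : ℂ) =
      Matrix.det (Matrix.of fun i j : Fin (N + 1) =>
        entryF c (symbol α β γ t₁ t₂ t₃) ((i : ℤ) - (j : ℤ)) (x.1 i.rev - y.1 j.rev)) := by
  by_cases hone : ∃ j ∈ Finset.Icc 1 t₁, α j = 1
  · obtain ⟨j, hj, hαj⟩ := hone
    rw [mixedTransition_eq_zero hj hαj, Complex.ofReal_zero, eq_comm]
    refine Matrix.det_eq_zero_of_row_eq_zero 0 fun k => ?_
    simp [entryF, contourIntegral, symbol_eq_zero hj hαj]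
  · push Not at hone
    have hα' : ∀ j ∈ Finset.Icc 1 t₁, α j ∈ Set.Ico (0 : ℝ) 1 := fun j hj =>
      ⟨(hα j hj).1, lt_of_le_of_ne (hα j hj).2 (hone j hj)⟩
    obtain ⟨R, hR, hRα⟩ := exists_radius hα'
    -- Reversing rows and columns simultaneously preserves the determinant and turns the index `j -
    -- i` into `i - j`.
    rw [mixedTransition_eq_detF hR (fun j hj => ⟨hα' j hj, hRα j hj⟩) hβ, detF,
      ← Matrix.det_submatrix_equiv_self Fin.revPerm]
    congr 1
    ext i j
    rw [Matrix.submatrix_apply, Matrix.of_apply, Matrix.of_apply,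
      entryF_eq_circleIntegral hc hc₀ hc₁ hR fun j hj h0 => ?_, circleF]
    · have h1 : (((Fin.revPerm j : Fin (N + 1)) : ℕ) : ℤ) - ((Fin.revPerm i : Fin (N + 1)) : ℕ) =
          (i : ℤ) - (j : ℤ) := by
        simp only [Fin.revPerm_apply, Fin.val_rev]
        omega
      rw [h1]
      rfl
    · have h1 : 0 < α j := lt_of_le_of_ne (hα' j hj).1 (Ne.symm h0)
      refine ⟨?_, hcα j hj h1 (hα' j hj).2⟩
      rw [lt_inv_comm₀ (by linarith) h1, lt_inv_comm₀ h1 (by linarith)]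
      rw [← one_div, lt_div_iff₀ h1, mul_comm]
      exact hRα j hj

/-! ### Processes -/

section process

variable {Ω : Type*} {mΩ : MeasurableSpace Ω} {P : Measure Ω} [IsFiniteMeasure P]

theorem hasSum_real_inter_preimage {A : Set Ω} (hA : MeasurableSet A) {X : Ω → Config N}
    (hX : Measurable X) : HasSum (fun a => P.real (A ∩ X ⁻¹' {a})) (P.real A) := by
  have hU : A = ⋃ a, A ∩ X ⁻¹' {a} := by
    ext ω
    simp
  have hm : ∀ a, MeasurableSet (A ∩ X ⁻¹' {a}) := fun a =>
    hA.inter (hX (measurableSet_singleton a))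
  have hd : Pairwise (Function.onFun Disjoint fun a => A ∩ X ⁻¹' {a}) := by
    intro a b hab
    refine Set.disjoint_left.2 fun ω h1 h2 => hab ?_
    rw [← show X ω = a from h1.2, ← show X ω = b from h2.2]
  have h : ∑' a, P (A ∩ X ⁻¹' {a}) = P A := by
    conv_rhs => rw [hU]
    exact (measure_iUnion hd hm).symm
  have h1 := ENNReal.hasSum_toReal (h.trans_ne (measure_ne_top P A))
  rwa [← ENNReal.tsum_toReal_eq fun a => measure_ne_top P _, h] at h1

/-- Chapman-Kolmogorov: decompose over the countably many values of the intermediate state `X`. It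
is applied with `A` the event that the process starts at `y`. -/
theorem real_inter_preimage_compose {A : Set Ω} (hA : MeasurableSet A) {X Y : Ω → Config N}
    (hX : Measurable X) (hY : Measurable Y) {p q : Config N → Config N → ℝ} {y : Config N}
    (hp : ∀ a, P.real (A ∩ X ⁻¹' {a}) = P.real A * p y a)
    (hq : ∀ a b, P.real (A ∩ X ⁻¹' {a} ∩ Y ⁻¹' {b}) = P.real (A ∩ X ⁻¹' {a}) * q a b)
    (b : Config N) : P.real (A ∩ Y ⁻¹' {b}) = P.real A * compose p q y b := by
  have h := hasSum_real_inter_preimage (P := P) (hA.inter (hY (measurableSet_singleton b))) hX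
  rw [← h.tsum_eq, compose, ← tsum_mul_left]
  refine tsum_congr fun a => ?_
  rw [Set.inter_right_comm, hq, hp, mul_assoc]

theorem IsMixedTASEP.real_inter_eq {α β : ℕ → ℝ} {γ : ℝ} {t₁ t₂ : ℕ} {t₃ : ℝ≥0}
    {ℱ : Filtration ℝ≥0 mΩ} {X : ℝ≥0 → Ω → Config (N + 1)}
    (h : IsMixedTASEP α β γ t₁ t₂ t₃ P ℱ X)
    (hα : ∀ j ∈ Finset.Icc 1 t₁, α j ∈ Set.Icc (0 : ℝ) 1)
    (hβ : ∀ j ∈ Finset.Icc (t₁ + 1) (t₁ + t₂), 0 ≤ β j) (y x : Config (N + 1)) :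
    P.real (X 0 ⁻¹' {y} ∩ X (t₁ + t₂ + t₃) ⁻¹' {x}) =
      P.real (X 0 ⁻¹' {y}) * mixedTransition α β γ t₁ t₂ t₃ y x := by
  have hX : ∀ s, Measurable (X s) := fun s => (h.adapted s).mono (ℱ.le s) le_rfl
  have hA : ∀ s, MeasurableSet[ℱ s] (X 0 ⁻¹' {y}) := fun s =>
    ℱ.mono zero_le _ (h.adapted 0 (measurableSet_singleton y))
  have hA0 : MeasurableSet (X 0 ⁻¹' {y}) := hX 0 (measurableSet_singleton y)
  have hgeo : ∀ k : ℕ, k ≤ t₁ → ∀ a, P.real (X 0 ⁻¹' {y} ∩ X k ⁻¹' {a}) =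
      P.real (X 0 ⁻¹' {y}) * geometricTransition α k y a := by
    intro k
    induction k with
    | zero =>
      intro _ a
      simp only [Nat.cast_zero, geometricTransition]
      split_ifs with hya
      · rw [hya, Set.inter_self, mul_one]
      · have : X 0 ⁻¹' {y} ∩ X 0 ⁻¹' {a} = ∅ := by
          rw [← Set.preimage_inter, Set.singleton_inter_eq_empty.2 (by simpa using hya),
            Set.preimage_empty]
        rw [this, measureReal_empty, mul_zero]
    | succ k ih =>
      intro hk a
      push_cast
      exact real_inter_preimage_compose hA0 (hX k) (hX (k + 1)) (ih (by omega))
        (fun a b => h.geometric k (by omega) _ (hA k) a b) a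
  have hbern : ∀ k : ℕ, k ≤ t₂ → ∀ a, P.real (X 0 ⁻¹' {y} ∩ X ((t₁ + k : ℕ) : ℝ≥0) ⁻¹' {a}) =
      P.real (X 0 ⁻¹' {y}) *
        compose (geometricTransition α t₁) (bernoulliTransition β t₁ k) y a := by
    intro k
    induction k with
    | zero =>
      intro _ a
      rw [add_zero, hgeo t₁ le_rfl a]
      congr 1
      simp [compose, bernoulliTransition]
    | succ k ih =>
      intro hk a
      have hb : β (t₁ + k + 1) / (1 + β (t₁ + k + 1)) ∈ Set.Icc (0 : ℝ) 1 :=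
        hopping_mem_Icc (hβ _ (by simp only [Finset.mem_Icc]; omega))
      have hstep := isSubstochastic_bernoulliStep (N := N + 1) hb
      have h1 : ∀ z, |bernoulliStep (β (t₁ + k + 1) / (1 + β (t₁ + k + 1))) z a| ≤ 1 := by
        intro z
        rw [abs_of_nonneg (hstep.nonneg z a)]
        exact ((hstep.summable z).le_tsum a fun b _ => hstep.nonneg z b).trans (hstep.tsum_le_one z)
      rw [bernoulliTransition, ← compose_assoc (isSubstochastic_geometricTransition hα)
        (isSubstochastic_bernoulliTransition fun j hj => hβ j (by
          simp only [Finset.mem_Icc] at hj ⊢; omega)) h1, ← add_assoc, Nat.cast_succ]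
      exact real_inter_preimage_compose hA0 (hX _) (hX _) (ih (by omega))
        (fun a b => h.bernoulli (t₁ + k) (by omega) (by omega) _ (hA _) a b) a
  refine real_inter_preimage_compose hA0 (hX (t₁ + t₂)) (hX _)
    (fun a => by simpa using hbern t₂ le_rfl a) (fun a b => ?_) x
  have := h.continuous 0 t₃ zero_le le_rfl _ (hA _) a b
  simpa using this

end process

end MixedTASEP

theorem proposition3 (N : ℕ) (hN : 1 ≤ N) (t₁ t₂ : ℕ) (t₃ : ℝ≥0) (α β : ℕ → ℝ) (γ : ℝ)
    (hα : ∀ j ∈ Finset.Icc 1 t₁, α j ∈ Set.Icc (0 : ℝ) 1)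
    (hβ : ∀ j ∈ Finset.Icc (t₁ + 1) (t₁ + t₂), 0 ≤ β j)
    (hγ : 0 < γ) (ht₃ : 0 < t₃)
    (c : ℝ → ℂ) (hc : MixedTASEP.IsSimpleLoop c)
    (hc₀ : MixedTASEP.Encloses c 0) (hc₁ : MixedTASEP.Encloses c 1)
    (hcα : ∀ j ∈ Finset.Icc 1 t₁, 0 < α j → α j < 1 →
      MixedTASEP.LeavesOutside c (((α j)⁻¹ : ℝ) : ℂ))
    (x y : MixedTASEP.Config N) :
    -- the transition function of the dynamics is the determinant
    (((MixedTASEP.mixedTransition α β γ t₁ t₂ t₃ y x : ℝ) : ℂ) =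
      Matrix.det (Matrix.of fun i j : Fin N =>
        MixedTASEP.entryF c (MixedTASEP.symbol α β γ t₁ t₂ t₃) ((i : ℤ) - (j : ℤ))
          (x.1 i.rev - y.1 j.rev))) ∧
    -- and so is the conditional probability `P(X_t = x | X_0 = y)` for every mixed TASEP `X`
    (∀ {Ω : Type*} {mΩ : MeasurableSpace Ω} (P : Measure Ω) [IsProbabilityMeasure P]
      (ℱ : Filtration ℝ≥0 mΩ) (X : ℝ≥0 → Ω → MixedTASEP.Config N),
      MixedTASEP.IsMixedTASEP α β γ t₁ t₂ t₃ P ℱ X → P (X 0 ⁻¹' {y}) ≠ 0 →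
      (((P[|X 0 ⁻¹' {y}]).real (X (t₁ + t₂ + t₃) ⁻¹' {x}) : ℝ) : ℂ) =
        Matrix.det (Matrix.of fun i j : Fin N =>
          MixedTASEP.entryF c (MixedTASEP.symbol α β γ t₁ t₂ t₃) ((i : ℤ) - (j : ℤ))
            (x.1 i.rev - y.1 j.rev))) := by
  obtain ⟨n, rfl⟩ : ∃ n, N = n + 1 := ⟨N - 1, by omega⟩
  have hdet := MixedTASEP.mixedTransition_eq_det (t₃ := t₃) (γ := γ) hα hβ hc hc₀ hc₁ hcα x y
  refine ⟨hdet, fun {Ω mΩ} P _ ℱ X hX hy => ?_⟩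
  have hmeas : MeasurableSet (X 0 ⁻¹' {y}) :=
    (hX.adapted 0).mono (ℱ.le 0) le_rfl (measurableSet_singleton y)
  have hP : P.real (X 0 ⁻¹' {y}) ≠ 0 := by
    rw [Measure.real, ENNReal.toReal_ne_zero]
    exact ⟨hy, measure_ne_top P _⟩
  rw [← hdet, Measure.real, cond_apply hmeas, ENNReal.toReal_mul, ENNReal.toReal_inv,
    ← Measure.real, ← Measure.real, hX.real_inter_eq hα hβ, inv_mul_cancel_left₀ hP]
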